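/- By a tree we mean a finite rooted planar binary tree. Let $V_{br}$ be the braided Thompson group: its elements are equivalence classes of triples $(T_-,b,T_+)$, where $T_-,T_+$ are trees with the same number $n$ of leaves and $b\in B_n$ is a braid on $n$ strands, under the equivalence relation generated by the expansions $(T_-,b,T_+)\sim(T_-\cup\lambda_{\rho_b(k)},\kappa_k(b),T_+\cup\lambda_k)$, $1\le k\le n$. Here $\rho_b\in S_n$ is the permutation of $b$ (strands are numbered at the bottom, and $\rho_b(k)$ is the position of the $k$th strand at the top), $\kappa_k(b)\in B_{n+1}$ is obtained from $b$ by replacing the $k$th strand by two parallel strands, and $T\cup\lambda_k$ is $T$ with a caret attached to its $k$th leaf. The product is induced by $(T_1,a,T_2)(T_2,b,T_3)=(T_1,ab,T_3)$. Thompson's group $V$ is defined in the same way with $S_n$ in place of $B_n$, and $P_{br}$ is the kernel of the homomorphism $V_{br}\to V$, $(T_-,b,T_+)\mapsto(T_-,\rho_b,T_+)$; for every tree $T$ with $n$ leaves and every pure braid $p\in PB_n$, the class of $(T,p,T)$ lies in $P_{br}$. **Proposition.** The group $P_{br}$ is not hopfian, that is, it has a surjective endomorphism that is not injective. More precisely,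 for a non-trivial tree $T$ let $T_L$ be the subtree whose root is the left child of the root of $T$, let $n(T_L)$ be its number of leaves, and for $m\le n$ let $\phi_{n,m}\colon PB_n\to PB_m$ be the homomorphism forgetting all strands of a pure braid except for the first $m$. Then there is a homomorphism $\phi_L\colon P_{br}\to P_{br}$ with $$\phi_L\bigl((T,p,T)\bigr)=(T_L,\phi_{n,n(T_L)}(p),T_L)$$ for every non-trivial tree $T$ with $n$ leaves and every $p\in PB_n$, and $\phi_L$ is surjective but not injective. -/

import Mathlib

namespace BraidedThompson

open Equiv

/-! ### Rooted binary trees -/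

/-- Finite rooted (planar) binary trees: `.nil` is the trivial tree (a single node, which is a
leaf), `.node () l r` is the tree whose root has left subtree `l` and right subtree `r`.
The number of leaves is `BinaryTree.numLeaves`. -/
abbrev BTree : Type := BinaryTree Unit

/-- The tree obtained by attaching a caret to the `k`-th leaf, leaves being numbered
`0, 1, …` from left to right. (Only used for `k < t.numLeaves`.) -/
def addCaret : BTree → ℕ → BTree
  | .nil, _ => .node () .nil .nil
  | .node _ l r, k =>
      if k < l.numLeaves then .node () (addCaret l k) r
      else .node () l (addCaret r (k - l.numLeaves))

theorem numLeaves_addCaret (t : BTree) (k : ℕ) :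
    (addCaret t k).numLeaves = t.numLeaves + 1 := by
  induction t generalizing k with
  | nil => simp [addCaret]
  | node a l r hl hr =>
    by_cases h : k < l.numLeaves
    · simp only [addCaret, h, if_true, BinaryTree.numLeaves, hl]; omega
    · simp only [addCaret, h, if_false, BinaryTree.numLeaves, hr]; omega

theorem addCaret_comm (t : BTree) (k l : ℕ) (hkl : k < l) (hl : l < t.numLeaves) :
    addCaret (addCaret t k) (l + 1) = addCaret (addCaret t l) k := by
  induction t generalizing k l with
  | nil => simp at hl; omega
  | node a s r hs hr =>
    simp only [BinaryTree.numLeaves] at hl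
    by_cases h1 : l < s.numLeaves
    · have h2 : k < s.numLeaves := by omega
      have h3 : l + 1 < s.numLeaves + 1 := by omega
      have h4 : k < s.numLeaves + 1 := by omega
      simp [addCaret, h1, h2, h4, numLeaves_addCaret, hs k l hkl h1]
    · by_cases h2 : k < s.numLeaves
      · simp [addCaret, h1, h2, numLeaves_addCaret]
      · have h3 : ¬ (l + 1 < s.numLeaves) := by omega
        have h4 : l + 1 - s.numLeaves = (l - s.numLeaves) + 1 := by omega
        simp [addCaret, h1, h2, h3]
        rw [h4]
        exact hr _ _ (by omega) (by omega)

/-- `Ext s t`: the tree `t` contains `s` as a rooted subtree, i.e. `t` arises from `s` by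
adding carets. -/
inductive Ext : BTree → BTree → Prop
  | nil (t : BTree) : Ext .nil t
  | node {a b c d : BTree} : Ext a c → Ext b d → Ext (.node () a b) (.node () c d)

theorem Ext.refl (t : BTree) : Ext t t := by
  induction t with
  | nil => exact .nil _
  | node a l r hl hr => exact .node hl hr

theorem Ext.trans {r s t : BTree} (h : Ext r s) (h' : Ext s t) : Ext r t := by
  induction h generalizing t with
  | nil _ => exact .nil _
  | node _ _ ih1 ih2 =>
    cases h' with
    | node h1 h2 => exact .node (ih1 h1) (ih2 h2)

theorem Ext.addCaret (t : BTree) (k : ℕ) : Ext t (addCaret t k) := by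
  induction t generalizing k with
  | nil => exact .nil _
  | node a l r hl hr =>
    unfold BraidedThompson.addCaret
    split_ifs
    · exact .node (hl _) (.refl _)
    · exact .node (.refl _) (hr _)

theorem Ext.numLeaves_le {s t : BTree} (h : Ext s t) : s.numLeaves ≤ t.numLeaves := by
  induction h with
  | nil t => exact t.numLeaves_pos
  | node _ _ h1 h2 => simp only [BinaryTree.numLeaves]; omega

theorem Ext.eq_or_step {s t : BTree} (h : Ext s t) :
    s = t ∨ ∃ k < s.numLeaves, Ext (BraidedThompson.addCaret s k) t := by
  induction h with
  | nil t =>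
    cases t with
    | nil => exact .inl rfl
    | node a l r => exact .inr ⟨0, by simp, .node (.nil _) (.nil _)⟩
  | @node a b c d h1 h2 ih1 ih2 =>
    rcases ih1 with rfl | ⟨k, hk, hk'⟩
    · rcases ih2 with rfl | ⟨k, hk, hk'⟩
      · exact .inl rfl
      · refine .inr ⟨a.numLeaves + k, by simpa using hk, ?_⟩
        simpa [BraidedThompson.addCaret] using Ext.node h1 hk'
    · refine .inr ⟨k, by simp only [BinaryTree.numLeaves]; omega, ?_⟩
      simpa [BraidedThompson.addCaret, hk] using Ext.node hk' h2

theorem Ext.addCaret_addCaret {s t : BTree} {k l : ℕ} (hkl : k < l) (hl : l < s.numLeaves)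
    (h1 : Ext (BraidedThompson.addCaret s k) t) (h2 : Ext (BraidedThompson.addCaret s l) t) :
    Ext (BraidedThompson.addCaret (BraidedThompson.addCaret s k) (l + 1)) t := by
  induction s generalizing k l t with
  | nil => simp at hl; omega
  | node a s r hs hr =>
    simp only [BinaryTree.numLeaves] at hl
    by_cases h3 : l < s.numLeaves
    · have h4 : k < s.numLeaves := by omega
      simp only [BraidedThompson.addCaret, h3, h4, if_true] at h1 h2
      cases h1 with
      | node h5 h6 =>
        cases h2 with
        | node h7 h8 =>
          have := hs hkl h3 h5 h7
          simpa [BraidedThompson.addCaret, h3, h4, numLeaves_addCaret] using Ext.node this h6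
    · by_cases h4 : k < s.numLeaves
      · simp only [BraidedThompson.addCaret, h3, h4, if_true, if_false] at h1 h2
        cases h1 with
        | node h5 h6 =>
          cases h2 with
          | node h7 h8 =>
            simpa [BraidedThompson.addCaret, h3, h4, numLeaves_addCaret] using Ext.node h5 h8
      · simp only [BraidedThompson.addCaret, h3, h4, if_false] at h1 h2
        have h9 : ¬ (l + 1 < s.numLeaves) := by omega
        have h10 : l + 1 - s.numLeaves = (l - s.numLeaves) + 1 := by omega
        cases h1 with
        | node h5 h6 =>
          cases h2 with
          | node h7 h8 =>
            have := hr (k := k - s.numLeaves) (l := l - s.numLeaves) (by omega) (by omega) h6 h8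
            simpa [BraidedThompson.addCaret, h4, h9, h10] using Ext.node h5 this

theorem Ext.exists_join (s t : BTree) : ∃ u, Ext s u ∧ Ext t u := by
  induction s generalizing t with
  | nil => exact ⟨t, .nil _, .refl _⟩
  | node a l r hl hr =>
    cases t with
    | nil => exact ⟨_, .refl _, .nil _⟩
    | node b l' r' =>
      obtain ⟨u, h1, h2⟩ := hl l'
      obtain ⟨v, h3, h4⟩ := hr r'
      exact ⟨.node () u v, .node h1 h3, .node h2 h4⟩

/-! ### Cloning systems and groups of tree diagrams -/

/-- Doubling the strand `k` of a permutation: the strand `k ↦ π k` is replaced by the two parallel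
strands `k ↦ π k` and `k + 1 ↦ π k + 1`. In other words one inserts a new strand immediately to the
left of the strand `k ↦ π k`. -/
def clonePerm {n : ℕ} (k : Fin n) (π : Perm (Fin n)) : Perm (Fin (n + 1)) :=
  (finSuccEquiv' k.castSucc).trans ((optionCongr π).trans (finSuccEquiv' (π k).castSucc).symm)

theorem clonePerm_castSucc {n : ℕ} (k : Fin n) (π : Perm (Fin n)) :
    clonePerm k π k.castSucc = (π k).castSucc := by
  simp [clonePerm]

theorem clonePerm_succAbove {n : ℕ} (k : Fin n) (π : Perm (Fin n)) (j : Fin n) :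
    clonePerm k π (k.castSucc.succAbove j) = (π k).castSucc.succAbove (π j) := by
  simp [clonePerm]

theorem clonePerm_succ {n : ℕ} (k : Fin n) (π : Perm (Fin n)) :
    clonePerm k π k.succ = (π k).succ := by
  have := clonePerm_succAbove k π k
  simpa using this

theorem clonePerm_succ_of_lt {n : ℕ} (π : Perm (Fin n)) {k l : Fin n} (h : k < l) :
    clonePerm k π l.succ = (π k).castSucc.succAbove (π l) := by
  rw [← clonePerm_succAbove, Fin.succAbove_castSucc_of_le _ _ h.le]

theorem clonePerm_castSucc_of_lt {n : ℕ} (π : Perm (Fin n)) {k l : Fin n} (h : k < l) :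
    clonePerm l π k.castSucc = (π l).castSucc.succAbove (π k) := by
  rw [← clonePerm_succAbove, Fin.succAbove_castSucc_of_lt _ _ h]

theorem clonePerm_mul {n : ℕ} (k : Fin n) (π τ : Perm (Fin n)) :
    clonePerm k (π * τ) = clonePerm (τ k) π * clonePerm k τ := by
  ext1 x
  induction x using Fin.succAboveCases k.castSucc with
  | x => simp [clonePerm_castSucc]
  | p j => simp [clonePerm_succAbove]


theorem clonePerm_clonePerm {n : ℕ} (π : Perm (Fin n)) {k l : Fin n} (h : k < l) :
    clonePerm l.succ (clonePerm k π) = clonePerm k.castSucc (clonePerm l π) := by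
  have hne : (π k : ℕ) ≠ π l := fun e => h.ne (π.injective (Fin.ext e))
  have e1 : l.succ.castSucc = k.castSucc.castSucc.succAbove l.castSucc := by
    rw [Fin.lt_def] at h
    simp only [Fin.ext_iff, Fin.succAbove, Fin.lt_def, Fin.val_castSucc, Fin.val_succ,
      apply_ite Fin.val]
    split_ifs <;> omega
  have e2 : l.succ.castSucc.succAbove k.castSucc = k.castSucc.castSucc := by
    rw [Fin.lt_def] at h
    simp only [Fin.ext_iff, Fin.succAbove, Fin.lt_def, Fin.val_castSucc, Fin.val_succ,
      apply_ite Fin.val]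
    split_ifs <;> omega
  ext1 x
  induction x using Fin.succAboveCases l.succ.castSucc with
  | x =>
    rw [clonePerm_castSucc, e1, clonePerm_succAbove, clonePerm_castSucc,
      clonePerm_castSucc_of_lt π h, clonePerm_succ_of_lt π h]
    simp only [Fin.ext_iff, Fin.succAbove, Fin.lt_def, Fin.val_castSucc, Fin.val_succ,
      apply_ite Fin.val]
    split_ifs <;> omega
  | p y =>
    rw [clonePerm_succAbove]
    induction y using Fin.succAboveCases k.castSucc with
    | x =>
      rw [e2, clonePerm_castSucc, clonePerm_castSucc, clonePerm_castSucc_of_lt π h,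
        clonePerm_succ_of_lt π h]
      simp only [Fin.ext_iff, Fin.succAbove, Fin.lt_def, Fin.val_castSucc, Fin.val_succ,
        apply_ite Fin.val]
      split_ifs <;> omega
    | p j =>
      have e3 : l.succ.castSucc.succAbove (k.castSucc.succAbove j) =
          k.castSucc.castSucc.succAbove (l.castSucc.succAbove j) := by
        simp only [Fin.ext_iff, Fin.succAbove, Fin.lt_def, Fin.val_castSucc, Fin.val_succ,
          apply_ite Fin.val] at h ⊢
        split_ifs <;> omega
      rw [e3, clonePerm_succAbove, clonePerm_succAbove, clonePerm_succAbove,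
        clonePerm_castSucc_of_lt π h, clonePerm_succ_of_lt π h]
      simp only [Fin.ext_iff, Fin.succAbove, Fin.lt_def, Fin.val_castSucc, Fin.val_succ,
        apply_ite Fin.val]
      split_ifs <;> omega

/-- The data needed to form groups of paired tree diagrams decorated with elements of groups
`G n`: homomorphisms `perm : G n → S_n` and cloning maps `clone k : G n → G (n + 1)`, doubling the
strand with number `k` *at the bottom*, where `perm g k` is the position at the top of the strand
that is at position `k` at the bottom. It is used for the symmetric groups (giving Thompson's
group `V`) and for the braid groups (giving the braided Thompson group). -/
structure CloningSystem (G : ℕ → Type) [∀ n, Group (G n)] where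
  /-- the permutation of an element -/
  perm {n : ℕ} : G n →* Perm (Fin n)
  /-- the cloning maps -/
  clone {n : ℕ} : Fin n → G n → G (n + 1)
  clone_mul {n : ℕ} (k : Fin n) (g h : G n) :
    clone k (g * h) = clone (perm h k) g * clone k h
  perm_clone {n : ℕ} (k : Fin n) (g : G n) : perm (clone k g) = clonePerm k (perm g)
  clone_clone {n : ℕ} {k l : Fin n} (h : k < l) (g : G n) :
    clone l.succ (clone k g) = clone k.castSucc (clone l g)

/-- A paired tree diagram `(T₋, g, T₊)`: two trees with the same number `n` of leaves, and an
element `g : G n`. We think of it as drawn with the splitting tree `T₋ = top` on top, then `g`,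
then the merging tree `T₊ = bot` at the bottom. -/
@[ext]
structure Diagram (G : ℕ → Type) where
  /-- the number of strands -/
  n : ℕ
  /-- the tree `T₋` -/
  top : BTree
  /-- the tree `T₊` -/
  bot : BTree
  top_leaves : top.numLeaves = n
  bot_leaves : bot.numLeaves = n
  /-- the element `g` -/
  elt : G n

/-- Turning a diagram upside down. -/
def Diagram.flip {G : ℕ → Type} [∀ n, Group (G n)] (x : Diagram G) : Diagram G where
  n := x.n
  top := x.bot
  bot := x.top
  top_leaves := x.bot_leaves
  bot_leaves := x.top_leaves
  elt := x.elt⁻¹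

/-- `Comp x y w`: the bottom tree of `x` equals the top tree of `y`, and `w` is obtained by stacking
`x` on top of `y` and cancelling these two trees:
`(T₁, g, T₂) (T₂, h, T₃) = (T₁, g h, T₃)`. -/
inductive Diagram.Comp {G : ℕ → Type} [∀ n, Group (G n)] :
    Diagram G → Diagram G → Diagram G → Prop
  | mk (n : ℕ) (T₁ T₂ T₃ : BTree) (h₁ : T₁.numLeaves = n) (h₂ : T₂.numLeaves = n)
      (h₃ : T₃.numLeaves = n) (g h : G n) :
      Comp ⟨n, T₁, T₂, h₁, h₂, g⟩ ⟨n, T₂, T₃, h₂, h₃, h⟩ ⟨n, T₁, T₃, h₁, h₃, g * h⟩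

namespace CloningSystem

variable {G : ℕ → Type} [∀ n, Group (G n)] (C : CloningSystem G)

/-- The `k`-th expansion `(T₋ ∪ λ_{ρ(k)}, κ_k(g), T₊ ∪ λ_k)` of `(T₋, g, T₊)`. -/
def expand (x : Diagram G) (k : Fin x.n) : Diagram G where
  n := x.n + 1
  top := addCaret x.top (C.perm x.elt k)
  bot := addCaret x.bot k
  top_leaves := by rw [numLeaves_addCaret, x.top_leaves]
  bot_leaves := by rw [numLeaves_addCaret, x.bot_leaves]
  elt := C.clone k x.elt

/-- `y` is an expansion of `x` (equivalently `x` is a reduction of `y`). -/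
def Step (x y : Diagram G) : Prop := ∃ k : Fin x.n, y = C.expand x k

/-- Equivalence of diagrams: being connected by a finite sequence of expansions and reductions. -/
def diagramSetoid : Setoid (Diagram G) := Relation.EqvGen.setoid C.Step

/-- The set of equivalence classes of diagrams. -/
def Thompson : Type := Quotient C.diagramSetoid

/-- The class of a diagram. -/
def cls (x : Diagram G) : C.Thompson := Quotient.mk C.diagramSetoid x

/-! Confluence of expansions. -/

theorem clone_one {n : ℕ} (k : Fin n) : C.clone k (1 : G n) = 1 := by
  have := C.clone_mul k 1 1
  simpa using this

theorem clone_inv {n : ℕ} (k : Fin n) (g : G n) :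
    C.clone (C.perm g k) g⁻¹ = (C.clone k g)⁻¹ := by
  have := C.clone_mul k g⁻¹ g
  rw [inv_mul_cancel, clone_one] at this
  exact eq_inv_of_mul_eq_one_left this.symm

/-- Iterated expansion. -/
abbrev Steps : Diagram G → Diagram G → Prop := Relation.ReflTransGen C.Step

theorem Step.ext_bot {x y : Diagram G} (h : C.Step x y) : Ext x.bot y.bot := by
  obtain ⟨k, rfl⟩ := h
  exact Ext.addCaret _ _

theorem Steps.ext_bot {x y : Diagram G} (h : C.Steps x y) : Ext x.bot y.bot := by
  induction h with
  | refl => exact .refl _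
  | tail _ h ih => exact ih.trans (Step.ext_bot C h)

/-- Expansions along the bottom tree. -/
theorem exists_steps_bot (x : Diagram G) (R : BTree) (h : Ext x.bot R) :
    ∃ y, C.Steps x y ∧ y.bot = R := by
  induction hN : R.numLeaves - x.n using Nat.strong_induction_on generalizing x with
  | _ N ih =>
    rcases h.eq_or_step with rfl | ⟨k, hk, hk'⟩
    · exact ⟨x, .refl, rfl⟩
    · have hk2 : k < x.n := by rw [← x.bot_leaves]; exact hk
      have h1 := hk'.numLeaves_le
      rw [numLeaves_addCaret, x.bot_leaves] at h1
      obtain ⟨y, hy, hy'⟩ := ih (R.numLeaves - (x.n + 1)) (by omega)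
        (C.expand x ⟨k, hk2⟩) hk' rfl
      exact ⟨y, hy.head ⟨_, rfl⟩, hy'⟩

theorem expand_expand (x : Diagram G) {k l : Fin x.n} (h : k < l) :
    C.expand (C.expand x k) l.succ = C.expand (C.expand x l) k.castSucc := by
  have hl : (l : ℕ) < x.bot.numLeaves := by rw [x.bot_leaves]; exact l.2
  have hb := addCaret_comm x.bot k l h hl
  have e1 := congrArg Fin.val (clonePerm_succ_of_lt (C.perm x.elt) h)
  have e2 := congrArg Fin.val (clonePerm_castSucc_of_lt (C.perm x.elt) h)
  have hne : (C.perm x.elt k : ℕ) ≠ C.perm x.elt l :=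
    fun e => h.ne ((C.perm x.elt).injective (Fin.ext e))
  have htl : x.top.numLeaves = x.n := x.top_leaves
  have ht : addCaret (addCaret x.top (C.perm x.elt k)) (C.perm (C.clone k x.elt) l.succ) =
      addCaret (addCaret x.top (C.perm x.elt l)) (C.perm (C.clone l x.elt) k.castSucc) := by
    rw [C.perm_clone, C.perm_clone, e1, e2]
    have h1 := (C.perm x.elt k).2
    have h2 := (C.perm x.elt l).2
    simp only [Fin.succAbove, Fin.lt_def, Fin.val_castSucc, apply_ite Fin.val, Fin.val_succ]
    rcases lt_or_gt_of_ne hne with h3 | h3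
    · rw [if_neg (by omega), if_pos h3]
      exact addCaret_comm _ _ _ h3 (by omega)
    · rw [if_pos h3, if_neg (by omega)]
      exact (addCaret_comm _ _ _ h3 (by omega)).symm
  have hc := C.clone_clone h x.elt
  ext1
  · rfl
  · exact ht
  · simpa [expand] using hb
  · exact heq_of_eq hc

theorem Steps.n_le {x y : Diagram G} (h : C.Steps x y) : x.n ≤ y.n := by
  have := (Steps.ext_bot C h).numLeaves_le
  rwa [x.bot_leaves, y.bot_leaves] at this

theorem Steps.eq_of_bot {x y z : Diagram G} (hy : C.Steps x y) (hz : C.Steps x z)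
    (h : y.bot = z.bot) : y = z := by
  have hn : y.n = z.n := by rw [← y.bot_leaves, ← z.bot_leaves, h]
  induction hN : y.n - x.n using Nat.strong_induction_on generalizing x y z with
  | _ N ih =>
    rcases hy.cases_head with rfl | ⟨x₁, ⟨k, rfl⟩, hy'⟩
    · rcases hz.cases_head with rfl | ⟨x₂, ⟨l, rfl⟩, hz'⟩
      · rfl
      · have := Steps.n_le C hz'
        simp only [expand] at this
        omega
    rcases hz.cases_head with rfl | ⟨x₂, ⟨l, rfl⟩, hz'⟩
    · have := Steps.n_le C hy'
      simp only [expand] at this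
      omega
    have hy1 : x.n + 1 ≤ y.n := Steps.n_le C hy'
    have key : ∀ (k l : Fin x.n) (y z : Diagram G), k < l → C.Steps (C.expand x k) y →
        C.Steps (C.expand x l) z → y.bot = z.bot → y.n = z.n → y.n - x.n = N → y = z := by
      intro k l y z hkl hy' hz' h hn hN
      have hy1 : x.n + 1 ≤ y.n := Steps.n_le C hy'
      have hE1 := Steps.ext_bot C hy'
      have hE2 := Steps.ext_bot C hz'
      rw [← h] at hE2
      have hE : Ext (C.expand (C.expand x k) l.succ).bot y.bot :=
        Ext.addCaret_addCaret (s := x.bot) (k := k) (l := l) hkl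
          (by rw [x.bot_leaves]; exact l.2) hE1 hE2
      obtain ⟨w, hw, hwb⟩ := C.exists_steps_bot _ _ hE
      have hwn : w.n = y.n := by rw [← w.bot_leaves, ← y.bot_leaves, hwb]
      have hw1 : C.Steps (C.expand x k) w := hw.head ⟨l.succ, rfl⟩
      have hw2 : C.Steps (C.expand x l) w := by
        rw [C.expand_expand x hkl] at hw
        exact hw.head ⟨k.castSucc, rfl⟩
      have a1 : y = w := ih (y.n - (x.n + 1)) (by omega) hy' hw1 hwb.symm hwn.symm rfl
      have a2 : z = w := ih (z.n - (x.n + 1)) (by omega) hz' hw2 (by rw [hwb, h])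
        (by rw [hwn, hn]) rfl
      rw [a1, a2]
    rcases lt_trichotomy k l with hkl | rfl | hkl
    · exact key k l y z hkl hy' hz' h hn hN
    · exact ih (y.n - (x.n + 1)) (by omega) hy' hz' h hn rfl
    · exact (key l k z y hkl hz' hy' h.symm hn.symm (by omega)).symm

theorem Steps.confluent {x y z : Diagram G} (hy : C.Steps x y) (hz : C.Steps x z) :
    ∃ w, C.Steps y w ∧ C.Steps z w := by
  obtain ⟨R, h1, h2⟩ := Ext.exists_join y.bot z.bot
  obtain ⟨w, hw, hwb⟩ := C.exists_steps_bot y R h1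
  obtain ⟨w', hw', hwb'⟩ := C.exists_steps_bot z R h2
  have : w = w' := Steps.eq_of_bot C (hy.trans hw) (hz.trans hw') (by rw [hwb, hwb'])
  exact ⟨w, hw, this ▸ hw'⟩

theorem cls_eq_of_steps {x y : Diagram G} (h : C.Steps x y) : C.cls x = C.cls y := by
  induction h with
  | refl => rfl
  | tail _ h ih => exact ih.trans (Quotient.sound (Relation.EqvGen.rel _ _ h))

/-- Two diagrams are equivalent if and only if they have a common iterated expansion. -/
theorem cls_eq_iff {x y : Diagram G} :
    C.cls x = C.cls y ↔ ∃ z, C.Steps x z ∧ C.Steps y z := by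
  constructor
  · intro h
    have h' : Relation.EqvGen C.Step x y := Quotient.exact h
    clear h
    induction h' with
    | rel x y h => exact ⟨y, .single h, .refl⟩
    | refl x => exact ⟨x, .refl, .refl⟩
    | symm x y _ ih =>
      obtain ⟨z, h1, h2⟩ := ih
      exact ⟨z, h2, h1⟩
    | trans x y z _ _ ih1 ih2 =>
      obtain ⟨u, h1, h2⟩ := ih1
      obtain ⟨v, h3, h4⟩ := ih2
      obtain ⟨w, h5, h6⟩ := Steps.confluent C h2 h3
      exact ⟨w, h1.trans h5, h4.trans h6⟩
  · rintro ⟨z, h1, h2⟩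
    rw [C.cls_eq_of_steps h1, C.cls_eq_of_steps h2]

/-! The group structure. -/

theorem flip_expand (x : Diagram G) (k : Fin x.n) :
    (C.expand x k).flip = C.expand x.flip (C.perm x.elt k) := by
  ext1
  · rfl
  · change addCaret x.bot k = addCaret x.bot (C.perm (n := x.n) x.elt⁻¹ (C.perm x.elt k))
    simp
  · rfl
  · exact heq_of_eq (C.clone_inv k x.elt).symm

theorem Steps.flip {x y : Diagram G} (h : C.Steps x y) : C.Steps x.flip y.flip := by
  induction h with
  | refl => exact .refl
  | tail _ h ih =>
    obtain ⟨k, rfl⟩ := h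
    exact ih.tail ⟨_, C.flip_expand _ k⟩

theorem _root_.BraidedThompson.Diagram.flip_flip (x : Diagram G) : x.flip.flip = x := by
  ext1
  · rfl
  · rfl
  · rfl
  · exact heq_of_eq (inv_inv (G := G x.n) x.elt)

theorem Steps.eq_of_top {x y z : Diagram G} (hy : C.Steps x y) (hz : C.Steps x z)
    (h : y.top = z.top) : y = z := by
  have := Steps.eq_of_bot C (Steps.flip C hy) (Steps.flip C hz) h
  rw [← y.flip_flip, this, z.flip_flip]

theorem exists_steps_top (x : Diagram G) (R : BTree) (h : Ext x.top R) :
    ∃ y, C.Steps x y ∧ y.top = R := by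
  obtain ⟨y, hy, hR⟩ := C.exists_steps_bot x.flip R h
  refine ⟨y.flip, ?_, hR⟩
  simpa only [Diagram.flip_flip] using Steps.flip C hy

theorem _root_.BraidedThompson.Diagram.exists_comp {x y : Diagram G} (h : x.bot = y.top) :
    ∃ w, Diagram.Comp x y w := by
  obtain ⟨n, S, T, h1, h2, a⟩ := x
  obtain ⟨m, T', U, h3, h4, b⟩ := y
  obtain rfl : T = T' := h
  obtain rfl : n = m := h2.symm.trans h3
  exact ⟨_, .mk ..⟩

theorem _root_.BraidedThompson.Diagram.Comp.unique {x y w w' : Diagram G}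
    (h : Diagram.Comp x y w) (h' : Diagram.Comp x y w') : w = w' := by
  cases h; cases h'; rfl

theorem _root_.BraidedThompson.Diagram.Comp.bot_eq_top {x y w : Diagram G}
    (h : Diagram.Comp x y w) : x.bot = y.top := by
  cases h; rfl

theorem _root_.BraidedThompson.Diagram.Comp.assoc {x y z u v w w' : Diagram G}
    (h1 : Diagram.Comp x y u) (h2 : Diagram.Comp y z v)
    (h3 : Diagram.Comp u z w) (h4 : Diagram.Comp x v w') : w = w' := by
  cases h1; cases h2; cases h3; cases h4
  simp [mul_assoc]

theorem comp_right {x y w y' : Diagram G} (h : Diagram.Comp x y w) (hy : C.Steps y y') :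
    ∃ x' w', C.Steps x x' ∧ C.Steps w w' ∧ Diagram.Comp x' y' w' := by
  induction hy with
  | refl => exact ⟨x, w, .refl, .refl, h⟩
  | tail _ hs ih =>
    obtain ⟨x₁, w₁, hx, hw, hc⟩ := ih
    obtain ⟨k, rfl⟩ := hs
    clear h
    cases hc with
    | mk n T₁ T₂ T₃ h₁ h₂ h₃ g h =>
    refine ⟨_, _, hx.tail ⟨C.perm h k, rfl⟩, hw.tail ⟨k, rfl⟩, ?_⟩
    simp only [expand, C.clone_mul, map_mul, Perm.mul_apply]
    exact .mk ..

theorem comp_left {x y w x' : Diagram G} (h : Diagram.Comp x y w) (hx : C.Steps x x') :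
    ∃ y' w', C.Steps y y' ∧ C.Steps w w' ∧ Diagram.Comp x' y' w' := by
  obtain ⟨y', hy, hy'⟩ := C.exists_steps_top y x'.bot
    (h.bot_eq_top ▸ Steps.ext_bot C hx)
  obtain ⟨x'', w', hx'', hw, hc⟩ := C.comp_right h hy
  have : x'' = x' := Steps.eq_of_bot C hx'' hx (hc.bot_eq_top.trans hy')
  exact ⟨y', w', hy, hw, this ▸ hc⟩

/-- `w` is a product of `x` and `y`: after expanding `x` and `y` so that the bottom tree of `x`
equals the top tree of `y`, stacking gives `w`. -/
def IsProduct (x y w : Diagram G) : Prop :=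
  ∃ x' y', C.Steps x x' ∧ C.Steps y y' ∧ Diagram.Comp x' y' w

theorem exists_isProduct (x y : Diagram G) : ∃ w, C.IsProduct x y w := by
  obtain ⟨R, h1, h2⟩ := Ext.exists_join x.bot y.top
  obtain ⟨x', hx, hx'⟩ := C.exists_steps_bot x R h1
  obtain ⟨y', hy, hy'⟩ := C.exists_steps_top y R h2
  obtain ⟨w, hw⟩ := Diagram.exists_comp (hx'.trans hy'.symm)
  exact ⟨w, x', y', hx, hy, hw⟩

theorem IsProduct.cls_eq {x y w x₂ y₂ w₂ : Diagram G} (h : C.IsProduct x y w)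
    (h₂ : C.IsProduct x₂ y₂ w₂) (hx : C.cls x = C.cls x₂) (hy : C.cls y = C.cls y₂) :
    C.cls w = C.cls w₂ := by
  obtain ⟨a, b, ha, hb, hc⟩ := h
  obtain ⟨a₂, b₂, ha₂, hb₂, hc₂⟩ := h₂
  rw [C.cls_eq_of_steps ha, C.cls_eq_of_steps ha₂, C.cls_eq_iff] at hx
  obtain ⟨z, hz, hz₂⟩ := hx
  obtain ⟨b', w', hb', hw', hc'⟩ := C.comp_left hc hz
  obtain ⟨b₂', w₂', hb₂', hw₂', hc₂'⟩ := C.comp_left hc₂ hz₂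
  rw [C.cls_eq_of_steps (hb.trans hb'), C.cls_eq_of_steps (hb₂.trans hb₂'), C.cls_eq_iff] at hy
  obtain ⟨v, hv, hv₂⟩ := hy
  obtain ⟨p, q, hp, hq, hpq⟩ := C.comp_right hc' hv
  obtain ⟨p₂, q₂, hp₂, hq₂, hpq₂⟩ := C.comp_right hc₂' hv₂
  have : p = p₂ := Steps.eq_of_bot C hp hp₂ (hpq.bot_eq_top.trans hpq₂.bot_eq_top.symm)
  subst this
  rw [C.cls_eq_of_steps (hw'.trans hq), C.cls_eq_of_steps (hw₂'.trans hq₂), hpq.unique hpq₂]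

/-- Multiplication of classes of diagrams by stacking: expand the diagrams `x` and `y` to diagrams
of the form `(T₁, g, T₂)` and `(T₂, h, T₃)`; the product is the class of `(T₁, g h, T₃)`. -/
noncomputable instance : Mul C.Thompson where
  mul := Quotient.lift₂ (fun x y => C.cls (C.exists_isProduct x y).choose) (by
    intro x y x₂ y₂ hx hy
    exact IsProduct.cls_eq C (C.exists_isProduct x y).choose_spec
      (C.exists_isProduct x₂ y₂).choose_spec (Quotient.sound hx) (Quotient.sound hy))

theorem cls_mul_cls {x y w : Diagram G} (h : C.IsProduct x y w) :
    C.cls x * C.cls y = C.cls w :=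
  IsProduct.cls_eq C (C.exists_isProduct x y).choose_spec h rfl rfl

theorem cls_mul_cls_of_comp {x y w : Diagram G} (h : Diagram.Comp x y w) :
    C.cls x * C.cls y = C.cls w :=
  C.cls_mul_cls ⟨x, y, .refl, .refl, h⟩

/-- The diagram `(T, g, T)`. -/
def _root_.BraidedThompson.Diagram.diag (T : BTree) (g : G T.numLeaves) : Diagram G :=
  ⟨T.numLeaves, T, T, rfl, rfl, g⟩

/-- The identity is the class of the diagram `(T, 1, T)` for `T` the trivial tree. -/
instance : One C.Thompson := ⟨C.cls (Diagram.diag .nil 1)⟩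

theorem cls_diag_one (T : BTree) : C.cls (Diagram.diag T 1) = 1 := by
  obtain ⟨y, hy, hyT⟩ := C.exists_steps_bot (Diagram.diag .nil 1) T (.nil T)
  have key : ∀ y, C.Steps (Diagram.diag .nil 1) y →
      ∃ (n : ℕ) (S : BTree) (h : S.numLeaves = n), y = ⟨n, S, S, h, h, 1⟩ := by
    intro y hy
    induction hy with
    | refl => exact ⟨_, _, rfl, rfl⟩
    | tail _ h ih =>
      obtain ⟨n, S, h, rfl⟩ := ih
      obtain ⟨k, rfl⟩ := h
      change Fin n at k
      refine ⟨n + 1, addCaret S k, by rw [numLeaves_addCaret, h], ?_⟩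
      simp only [expand, clone_one, map_one, Perm.one_apply]
  obtain ⟨n, S, h, rfl⟩ := key y hy
  obtain rfl : S = T := hyT
  subst h
  exact (C.cls_eq_of_steps hy).symm

theorem cls_one_of_eq (n : ℕ) (T : BTree) (h h' : T.numLeaves = n) :
    C.cls ⟨n, T, T, h, h', 1⟩ = 1 := by
  subst h
  exact C.cls_diag_one T

theorem flip_cls {x y : Diagram G} (h : C.cls x = C.cls y) : C.cls x.flip = C.cls y.flip := by
  rw [cls_eq_iff] at h ⊢
  obtain ⟨z, h1, h2⟩ := h
  exact ⟨z.flip, Steps.flip C h1, Steps.flip C h2⟩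

/-- The inverse of `(T₋, g, T₊)` is `(T₊, g⁻¹, T₋)`. -/
instance : Inv C.Thompson where
  inv := Quotient.lift (fun x => C.cls x.flip) (by
    intro x y h
    exact C.flip_cls (Quotient.sound h))

theorem inv_cls (x : Diagram G) : (C.cls x)⁻¹ = C.cls x.flip := rfl

theorem exists_cls (g : C.Thompson) : ∃ x, C.cls x = g := Quotient.exists_rep g

/-- The group of classes of diagrams under stacking. -/
noncomputable instance : Group C.Thompson :=
  Group.ofLeftAxioms
    (by
      intro a b c
      obtain ⟨x, rfl⟩ := C.exists_cls a
      obtain ⟨y, rfl⟩ := C.exists_cls b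
      obtain ⟨z, rfl⟩ := C.exists_cls c
      obtain ⟨u, x₁, y₁, hx₁, hy₁, hu⟩ := C.exists_isProduct x y
      obtain ⟨v, y₂, z₂, hy₂, hz₂, hv⟩ := C.exists_isProduct y₁ z
      obtain ⟨x₂, u₂, hx₂, hu₂, hc⟩ := C.comp_right hu hy₂
      have e1 : u₂.bot = z₂.top := by
        have : u₂.bot = y₂.bot := by cases hc; rfl
        rw [this, hv.bot_eq_top]
      have e2 : x₂.bot = v.top := by
        have : v.top = y₂.top := by cases hv; rfl
        rw [this, hc.bot_eq_top]
      obtain ⟨w, hw⟩ := Diagram.exists_comp e1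
      obtain ⟨w', hw'⟩ := Diagram.exists_comp e2
      rw [C.cls_eq_of_steps (hx₁.trans hx₂), C.cls_eq_of_steps (hy₁.trans hy₂),
        C.cls_eq_of_steps hz₂, C.cls_mul_cls_of_comp hc, C.cls_mul_cls_of_comp hv,
        C.cls_mul_cls_of_comp hw, C.cls_mul_cls_of_comp hw', hc.assoc hv hw hw'])
    (by
      intro a
      obtain ⟨x, rfl⟩ := C.exists_cls a
      obtain ⟨n, S, T, h1, h2, g⟩ := x
      rw [← C.cls_one_of_eq n S h1 h1, C.cls_mul_cls_of_comp (.mk ..), one_mul])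
    (by
      intro a
      obtain ⟨x, rfl⟩ := C.exists_cls a
      obtain ⟨n, S, T, h1, h2, g⟩ := x
      rw [inv_cls]
      simp only [Diagram.flip]
      rw [C.cls_mul_cls_of_comp (.mk ..), inv_mul_cancel, C.cls_one_of_eq])

end CloningSystem

/-- The symmetric groups with the usual doubling of strands. -/
def permSystem : CloningSystem (fun n => Perm (Fin n)) where
  perm := MonoidHom.id _
  clone k π := clonePerm k π
  clone_mul k π τ := clonePerm_mul k π τ
  perm_clone _ _ := rfl
  clone_clone h π := clonePerm_clonePerm π h

/-- Thompson's group `V`: classes of paired tree diagrams `(T₋, π, T₊)` with `π` a permutation. -/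
abbrev V : Type := permSystem.Thompson

namespace CloningSystem

variable {G : ℕ → Type} [∀ n, Group (G n)] (C : CloningSystem G)

/-- Replacing the group element of a diagram by its permutation. -/
def permDiagram (x : Diagram G) : Diagram (fun n => Perm (Fin n)) :=
  ⟨x.n, x.top, x.bot, x.top_leaves, x.bot_leaves, C.perm x.elt⟩

theorem permDiagram_expand (x : Diagram G) (k : Fin x.n) :
    C.permDiagram (C.expand x k) = permSystem.expand (C.permDiagram x) k := by
  ext1
  · rfl
  · rfl
  · rfl
  · exact heq_of_eq (C.perm_clone k x.elt)

theorem Steps.permDiagram {x y : Diagram G} (h : C.Steps x y) :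
    permSystem.Steps (C.permDiagram x) (C.permDiagram y) := by
  induction h with
  | refl => exact .refl
  | tail _ h ih =>
    obtain ⟨k, rfl⟩ := h
    exact ih.tail ⟨_, C.permDiagram_expand _ k⟩

/-- The homomorphism to `V` sending the class of `(T₋, g, T₊)` to the class of
`(T₋, ρ_g, T₊)`, where `ρ_g` is the permutation of `g`. -/
noncomputable def toV : C.Thompson →* V :=
  MonoidHom.mk' (Quotient.lift (fun x => permSystem.cls (C.permDiagram x)) (by
    intro x y h
    obtain ⟨z, h1, h2⟩ := C.cls_eq_iff.1 (Quotient.sound h : C.cls x = C.cls y)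
    exact permSystem.cls_eq_iff.2 ⟨_, Steps.permDiagram C h1, Steps.permDiagram C h2⟩))
    (by
      intro a b
      obtain ⟨x, rfl⟩ := C.exists_cls a
      obtain ⟨y, rfl⟩ := C.exists_cls b
      obtain ⟨w, x', y', hx, hy, hw⟩ := C.exists_isProduct x y
      rw [C.cls_mul_cls ⟨x', y', hx, hy, hw⟩]
      refine (permSystem.cls_mul_cls
        ⟨_, _, Steps.permDiagram C hx, Steps.permDiagram C hy, ?_⟩).symm
      cases hw
      simp only [CloningSystem.permDiagram, map_mul]
      exact .mk ..)

theorem toV_cls (x : Diagram G) : C.toV (C.cls x) = permSystem.cls (C.permDiagram x) := rfl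

end CloningSystem

/-! ### Braid groups -/

/-- Artin's relations on the generators `σ_0, …, σ_{n-2}`. -/
def braidRels (n : ℕ) : Set (FreeGroup (Fin (n - 1))) :=
  {r | ∃ i j : Fin (n - 1), (i : ℕ) + 1 < j ∧
      r = FreeGroup.of i * FreeGroup.of j * (FreeGroup.of j * FreeGroup.of i)⁻¹} ∪
  {r | ∃ i j : Fin (n - 1), (i : ℕ) + 1 = j ∧
      r = FreeGroup.of i * FreeGroup.of j * FreeGroup.of i *
        (FreeGroup.of j * FreeGroup.of i * FreeGroup.of j)⁻¹}

/-- The braid group `B_n` on `n` strands, given by Artin's presentation. The strands are at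
positions `0, …, n - 1`; the generator `σ_i` crosses the strands at positions `i` and `i + 1`, and
the product `b * c` is `b` stacked on top of `c`. -/
abbrev Braid (n : ℕ) : Type := PresentedGroup (braidRels n)

namespace Braid

/-- The generator `σ_i` of `B_n`, for `i + 1 < n` (and `1` for other `i`). -/
def sig (n i : ℕ) : Braid n :=
  if h : i < n - 1 then PresentedGroup.of (⟨i, h⟩ : Fin (n - 1)) else 1

theorem of_eq_sig {n : ℕ} (i : Fin (n - 1)) :
    (PresentedGroup.of i : Braid n) = sig n i := by
  simp [sig]

theorem sig_comm {n i j : ℕ} (hij : i + 1 < j) : sig n i * sig n j = sig n j * sig n i := by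
  by_cases hj : j < n - 1
  · have hi : i < n - 1 := by omega
    simp only [sig, hi, hj, dif_pos]
    exact PresentedGroup.mk_eq_mk_of_mul_inv_mem (.inl ⟨⟨i, hi⟩, ⟨j, hj⟩, hij, rfl⟩)
  · simp [sig, hj]

theorem sig_braid {n i : ℕ} (h : i + 2 < n) :
    sig n i * sig n (i + 1) * sig n i = sig n (i + 1) * sig n i * sig n (i + 1) := by
  have hi : i < n - 1 := by omega
  have hj : i + 1 < n - 1 := by omega
  simp only [sig, hi, hj, dif_pos]
  exact PresentedGroup.mk_eq_mk_of_mul_inv_mem (.inr ⟨⟨i, hi⟩, ⟨i + 1, hj⟩, rfl, rfl⟩)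

section lift

variable {n : ℕ} {H : Type} [Group H] (f : ℕ → H)
  (hcomm : ∀ i j, i + 1 < j → j + 1 < n → f i * f j = f j * f i)
  (hbraid : ∀ i, i + 2 < n → f i * f (i + 1) * f i = f (i + 1) * f i * f (i + 1))

/-- The homomorphism `B_n → H` with prescribed values on the generators. -/
def lift : Braid n →* H :=
  PresentedGroup.toGroup (f := fun i : Fin (n - 1) => f i) (by
    rintro r (⟨i, j, hij, rfl⟩ | ⟨i, j, hij, rfl⟩)
    · have := j.2
      simp only [map_mul, map_inv, FreeGroup.lift_apply_of, mul_inv_eq_one]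
      exact hcomm i j hij (by omega)
    · have := j.2
      simp only [map_mul, map_inv, FreeGroup.lift_apply_of, mul_inv_eq_one, ← hij]
      exact hbraid i (by omega))

theorem lift_sig {i : ℕ} (hi : i + 1 < n) : lift f hcomm hbraid (sig n i) = f i := by
  have h : i < n - 1 := by omega
  simp only [sig, h, dif_pos, lift]
  exact PresentedGroup.toGroup.of _

end lift

theorem induction {n : ℕ} {P : Braid n → Prop} (one : P 1) (mul : ∀ a b, P a → P b → P (a * b))
    (inv : ∀ a, P a → P a⁻¹) (sig : ∀ i, i + 1 < n → P (sig n i)) (b : Braid n) : P b := by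
  have hb : b ∈ Subgroup.closure (Set.range (PresentedGroup.of (rels := braidRels n))) := by
    rw [PresentedGroup.closure_range_of]; trivial
  induction hb using Subgroup.closure_induction with
  | mem x hx =>
    obtain ⟨i, rfl⟩ := hx
    rw [of_eq_sig]
    exact sig _ (by omega)
  | one => exact one
  | mul x y _ _ hx hy => exact mul _ _ hx hy
  | inv x _ hx => exact inv _ hx

/-- The transposition of `i` and `i + 1` in the symmetric group on `{0, …, n - 1}`. -/
def adj (n i : ℕ) : Perm (Fin n) :=
  if h : i + 1 < n then Equiv.swap ⟨i, by omega⟩ ⟨i + 1, h⟩ else 1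

theorem adj_val {n i : ℕ} (h : i + 1 < n) (x : Fin n) :
    (adj n i x : ℕ) = if (x : ℕ) = i then i + 1 else if (x : ℕ) = i + 1 then i else x := by
  simp only [adj, h, dif_pos, Equiv.swap_apply_def, Fin.ext_iff]
  split_ifs <;> rfl

theorem adj_comm {n i j : ℕ} (hij : i + 1 < j) (hj : j + 1 < n) :
    adj n i * adj n j = adj n j * adj n i := by
  ext x
  simp only [Perm.mul_apply, adj_val hj, adj_val (show i + 1 < n by omega)]
  split_ifs <;> omega

theorem adj_braid {n i : ℕ} (h : i + 2 < n) :
    adj n i * adj n (i + 1) * adj n i = adj n (i + 1) * adj n i * adj n (i + 1) := by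
  ext x
  simp only [Perm.mul_apply, adj_val (show i + 1 + 1 < n from h),
    adj_val (show i + 1 < n by omega)]
  split_ifs <;> omega

/-- The permutation `ρ_b` of a braid `b`: the strand at position `k` at the bottom is at position
`perm b k` at the top. -/
def perm {n : ℕ} : Braid n →* Perm (Fin n) :=
  lift (adj n) (fun _ _ h h' => adj_comm h h') (fun _ h => adj_braid h)

theorem perm_sig {n i : ℕ} (hi : i + 1 < n) : perm (sig n i) = adj n i := lift_sig _ _ _ hi

section cocycle

/-! Cloning and deleting strands are crossed homomorphisms `f : Fin n → B_n → H`, that is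
`f k (b * c) = f (ρ_c k) b * f k c`, since the strand at position `k` at the bottom of `b * c` is
at position `ρ_c k` at the bottom of `b`. A crossed homomorphism is determined by its values
`c i k = f k σ_i`, and it exists if these are compatible with Artin's relations. -/

variable {n : ℕ} {H : Type} [Group H] (c : ℕ → Fin n → H)
  (hcomm : ∀ i j, i + 1 < j → j + 1 < n → ∀ k,
    c i (adj n j k) * c j k = c j (adj n i k) * c i k)
  (hbraid : ∀ i, i + 2 < n → ∀ k,
    c i (adj n (i + 1) (adj n i k)) * c (i + 1) (adj n i k) * c i k =
      c (i + 1) (adj n i (adj n (i + 1) k)) * c i (adj n (i + 1) k) * c (i + 1) k)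

/-- The action of `B_n` on `Fin n × H` given by `b • (k, h) = (ρ_b k, f k b * h)`. -/
def cocycleAction : Braid n →* Perm (Fin n × H) :=
  lift (fun i => Equiv.prodShear (adj n i) (fun k => Equiv.mulLeft (c i k)))
    (by
      intro i j h h'
      ext1 ⟨k, x⟩
      have e := Equiv.congr_fun (adj_comm h h') k
      simp only [Perm.mul_apply] at e
      simp only [Perm.mul_apply, Equiv.prodShear_apply, Equiv.coe_mulLeft, ← mul_assoc,
        hcomm i j h h' k, e])
    (by
      intro i h
      ext1 ⟨k, x⟩
      have e := Equiv.congr_fun (adj_braid h) k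
      simp only [Perm.mul_apply] at e
      simp only [Perm.mul_apply, Equiv.prodShear_apply, Equiv.coe_mulLeft, ← mul_assoc,
        hbraid i h k, e])

/-- The crossed homomorphism with `cocycle k σ_i = c i k`. -/
def cocycle (k : Fin n) (b : Braid n) : H := (cocycleAction c hcomm hbraid b (k, 1)).2

theorem cocycleAction_apply (b : Braid n) (k : Fin n) (h : H) :
    cocycleAction c hcomm hbraid b (k, h) = (perm b k, cocycle c hcomm hbraid k b * h) := by
  induction b using Braid.induction generalizing k h with
  | one => simp [cocycle]
  | mul a b ha hb =>
    simp only [cocycle, map_mul, Perm.mul_apply]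
    rw [hb, ha, hb, ha]
    simp [mul_assoc]
  | inv a ha =>
    have e : ∀ (k : Fin n) (h : H), cocycleAction c hcomm hbraid a⁻¹ (k, h) =
        (perm a⁻¹ k, (cocycle c hcomm hbraid (perm a⁻¹ k) a)⁻¹ * h) := by
      intro k h
      rw [map_inv, Perm.inv_eq_iff_eq, ha]
      simp
    have e2 : cocycle c hcomm hbraid k a⁻¹ = (cocycle c hcomm hbraid (perm a⁻¹ k) a)⁻¹ := by
      change (cocycleAction c hcomm hbraid a⁻¹ (k, 1)).2 = _
      rw [e, mul_one]
    rw [e, e2]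
  | sig i hi =>
    simp [cocycle, cocycleAction, lift_sig _ _ _ hi, perm_sig hi]

theorem cocycle_sig {i : ℕ} (hi : i + 1 < n) (k : Fin n) :
    cocycle c hcomm hbraid k (sig n i) = c i k := by
  simp [cocycle, cocycleAction, lift_sig _ _ _ hi]

theorem cocycle_mul (k : Fin n) (a b : Braid n) :
    cocycle c hcomm hbraid k (a * b) =
      cocycle c hcomm hbraid (perm b k) a * cocycle c hcomm hbraid k b := by
  have h := cocycleAction_apply c hcomm hbraid (a * b) k 1
  rw [map_mul, Perm.mul_apply, cocycleAction_apply, cocycleAction_apply] at h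
  simpa using (congrArg Prod.snd h).symm

end cocycle

/-- The braid in `B_{n+1}` obtained from `σ_i ∈ B_n` by doubling the strand that is at position `k`
at the bottom. For `k = i` two parallel strands cross one strand on their right, giving
`σ_i σ_{i+1}`; for `k = i + 1` they cross one strand on their left, giving `σ_{i+1} σ_i`. -/
def cloneSig (n i : ℕ) (k : Fin n) : Braid (n + 1) :=
  if (k : ℕ) < i then sig (n + 1) (i + 1)
  else if (k : ℕ) = i then sig (n + 1) i * sig (n + 1) (i + 1)
  else if (k : ℕ) = i + 1 then sig (n + 1) (i + 1) * sig (n + 1) i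
  else sig (n + 1) i

/-- The braid in `B_n` obtained from `σ_i ∈ B_{n+1}` by deleting the strand that is at position `k`
at the bottom. -/
def deleteSig (n i : ℕ) (k : Fin (n + 1)) : Braid n :=
  if (k : ℕ) < i then sig n (i - 1)
  else if (k : ℕ) = i ∨ (k : ℕ) = i + 1 then 1
  else sig n i

theorem adj_cases {n i : ℕ} (h : i + 1 < n) (x : Fin n) :
    ((x : ℕ) = i ∧ (adj n i x : ℕ) = i + 1) ∨ ((x : ℕ) = i + 1 ∧ (adj n i x : ℕ) = i) ∨
      ((x : ℕ) ≠ i ∧ (x : ℕ) ≠ i + 1 ∧ (adj n i x : ℕ) = x) := by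
  rw [adj_val h]
  split_ifs <;> omega

theorem cloneSig_lt {n i : ℕ} {k : Fin n} (h : (k : ℕ) < i) :
    cloneSig n i k = sig (n + 1) (i + 1) := by
  simp [cloneSig, h]

theorem cloneSig_eq {n i : ℕ} {k : Fin n} (h : (k : ℕ) = i) :
    cloneSig n i k = sig (n + 1) i * sig (n + 1) (i + 1) := by
  simp [cloneSig, h]

theorem cloneSig_succ {n i : ℕ} {k : Fin n} (h : (k : ℕ) = i + 1) :
    cloneSig n i k = sig (n + 1) (i + 1) * sig (n + 1) i := by
  simp [cloneSig, h]

theorem cloneSig_gt {n i : ℕ} {k : Fin n} (h : i + 1 < (k : ℕ)) :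
    cloneSig n i k = sig (n + 1) i := by
  have h1 : ¬ (k : ℕ) < i := by omega
  have h2 : ¬ (k : ℕ) = i := by omega
  have h3 : ¬ (k : ℕ) = i + 1 := by omega
  simp only [cloneSig, h1, h2, h3, if_false]

theorem deleteSig_lt {n i : ℕ} {k : Fin (n + 1)} (h : (k : ℕ) < i) :
    deleteSig n i k = sig n (i - 1) := by
  simp [deleteSig, h]

theorem deleteSig_eq {n i : ℕ} {k : Fin (n + 1)} (h : (k : ℕ) = i ∨ (k : ℕ) = i + 1) :
    deleteSig n i k = 1 := by
  have h1 : ¬ (k : ℕ) < i := by omega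
  simp only [deleteSig, h1, h, if_false, if_true]

theorem deleteSig_gt {n i : ℕ} {k : Fin (n + 1)} (h : i + 1 < (k : ℕ)) :
    deleteSig n i k = sig n i := by
  have h1 : ¬ (k : ℕ) < i := by omega
  have h2 : ¬ ((k : ℕ) = i ∨ (k : ℕ) = i + 1) := by omega
  simp only [deleteSig, h1, h2, if_false]

theorem cloneSig_comm {n i j : ℕ} (hij : i + 1 < j) (hj : j + 1 < n) (k : Fin n) :
    cloneSig n i (adj n j k) * cloneSig n j k = cloneSig n j (adj n i k) * cloneSig n i k := by
  have hi : i + 1 < n := by omega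
  have c1 : Commute (sig (n + 1) i) (sig (n + 1) j) := sig_comm (by omega)
  have c2 : Commute (sig (n + 1) i) (sig (n + 1) (j + 1)) := sig_comm (by omega)
  have c3 : Commute (sig (n + 1) (i + 1)) (sig (n + 1) (j + 1)) := sig_comm (by omega)
  have v := adj_cases hi k
  have w := adj_cases hj k
  generalize adj n i k = p at *
  generalize adj n j k = q at *
  obtain h0 | h0 | h0 | h0 | h0 | h0 | h0 :
      (k : ℕ) < i ∨ (k : ℕ) = i ∨ (k : ℕ) = i + 1 ∨ (i + 1 < (k : ℕ) ∧ (k : ℕ) < j) ∨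
        (k : ℕ) = j ∨ (k : ℕ) = j + 1 ∨ j + 1 < (k : ℕ) := by omega
  all_goals
    simp (disch := omega) only [cloneSig_lt, cloneSig_eq, cloneSig_succ, cloneSig_gt]
  · exact c3.eq
  · exact (c2.mul_left c3).eq
  · exact (c3.mul_left c2).eq
  · exact c2.eq
  · exact (c1.mul_right c2).eq
  · exact (c2.mul_right c1).eq
  · exact c1.eq

theorem clone_words {H : Type} [Group H] {a b c : H} (r1 : a * b * a = b * a * b)
    (r2 : b * c * b = c * b * c) (r3 : a * c = c * a) :
    a * (b * c) * (a * b) = b * c * (a * b) * c ∧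
    a * b * c * (b * a) = c * b * a * (b * c) ∧
    b * a * (c * b) * a = c * (b * a) * (c * b) := by
  have t1 : a * (b * c) * (a * b) = b * c * (a * b) * c := by
    calc a * (b * c) * (a * b) = a * b * (c * a) * b := by simp only [mul_assoc]
      _ = a * b * a * (c * b) := by rw [← r3]; simp only [mul_assoc]
      _ = b * a * (b * c * b) := by rw [r1]; simp only [mul_assoc]
      _ = b * (a * c) * (b * c) := by rw [r2]; simp only [mul_assoc]
      _ = b * c * (a * b) * c := by rw [r3]; simp only [mul_assoc]
  have t2 : a * b * c * (b * a) = c * b * a * (b * c) := by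
    calc a * b * c * (b * a) = a * (b * c * b) * a := by simp only [mul_assoc]
      _ = (a * c) * b * (c * a) := by rw [r2]; simp only [mul_assoc]
      _ = c * (a * b * a) * c := by rw [← r3, r3]; simp only [mul_assoc, r3]
      _ = c * b * a * (b * c) := by rw [r1]; simp only [mul_assoc]
  have t3 : b * a * (c * b) * a = c * (b * a) * (c * b) := by
    calc b * a * (c * b) * a = b * (a * c) * b * a := by simp only [mul_assoc]
      _ = b * c * (a * b * a) := by rw [r3]; simp only [mul_assoc]
      _ = b * c * b * (a * b) := by rw [r1]; simp only [mul_assoc]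
      _ = c * b * (c * a) * b := by rw [r2]; simp only [mul_assoc]
      _ = c * (b * a) * (c * b) := by rw [← r3]; simp only [mul_assoc]
  exact ⟨t1, t2, t3⟩

theorem cloneSig_braid {n i : ℕ} (h : i + 2 < n) (k : Fin n) :
    cloneSig n i (adj n (i + 1) (adj n i k)) * cloneSig n (i + 1) (adj n i k) * cloneSig n i k =
      cloneSig n (i + 1) (adj n i (adj n (i + 1) k)) * cloneSig n i (adj n (i + 1) k) *
        cloneSig n (i + 1) k := by
  have hi : i + 1 < n := by omega
  have hj : i + 1 + 1 < n := h
  have r1 : sig (n + 1) i * sig (n + 1) (i + 1) * sig (n + 1) i =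
      sig (n + 1) (i + 1) * sig (n + 1) i * sig (n + 1) (i + 1) := sig_braid (by omega)
  have r2 : sig (n + 1) (i + 1) * sig (n + 1) (i + 1 + 1) * sig (n + 1) (i + 1) =
      sig (n + 1) (i + 1 + 1) * sig (n + 1) (i + 1) * sig (n + 1) (i + 1 + 1) :=
    sig_braid (by omega)
  have r3 : sig (n + 1) i * sig (n + 1) (i + 1 + 1) = sig (n + 1) (i + 1 + 1) * sig (n + 1) i :=
    sig_comm (by omega)
  have v1 := adj_cases hi k
  have v2 := adj_cases hj (adj n i k)
  have w1 := adj_cases hj k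
  have w2 := adj_cases hi (adj n (i + 1) k)
  generalize adj n (i + 1) (adj n i k) = p2 at *
  generalize adj n i k = p1 at *
  generalize adj n i (adj n (i + 1) k) = q2 at *
  generalize adj n (i + 1) k = q1 at *
  obtain h0 | h0 | h0 | h0 | h0 :
      (k : ℕ) < i ∨ (k : ℕ) = i ∨ (k : ℕ) = i + 1 ∨ (k : ℕ) = i + 1 + 1 ∨
        i + 1 + 1 < (k : ℕ) := by omega
  all_goals
    simp (disch := omega) only [cloneSig_lt, cloneSig_eq, cloneSig_succ, cloneSig_gt]
  · exact r2
  · exact (clone_words r1 r2 r3).1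
  · exact (clone_words r1 r2 r3).2.1
  · exact (clone_words r1 r2 r3).2.2
  · exact r1

theorem deleteSig_comm {n i j : ℕ} (hij : i + 1 < j) (hj : j + 1 < n + 1) (k : Fin (n + 1)) :
    deleteSig n i (adj (n + 1) j k) * deleteSig n j k =
      deleteSig n j (adj (n + 1) i k) * deleteSig n i k := by
  have hi : i + 1 < n + 1 := by omega
  have c1 : Commute (sig n i) (sig n j) := sig_comm (by omega)
  have v := adj_cases hi k
  have w := adj_cases hj k
  generalize adj (n + 1) i k = p at *
  generalize adj (n + 1) j k = q at *
  obtain h0 | h0 | h0 | h0 | h0 | h0 | h0 :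
      (k : ℕ) < i ∨ (k : ℕ) = i ∨ (k : ℕ) = i + 1 ∨ (i + 1 < (k : ℕ) ∧ (k : ℕ) < j) ∨
        (k : ℕ) = j ∨ (k : ℕ) = j + 1 ∨ j + 1 < (k : ℕ) := by omega
  all_goals
    simp (disch := omega) only [deleteSig_lt, deleteSig_eq, deleteSig_gt, one_mul, mul_one]
  · exact sig_comm (by omega)
  · exact sig_comm (by omega)
  · exact c1.eq

theorem deleteSig_braid {n i : ℕ} (h : i + 2 < n + 1) (k : Fin (n + 1)) :
    deleteSig n i (adj (n + 1) (i + 1) (adj (n + 1) i k)) *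
        deleteSig n (i + 1) (adj (n + 1) i k) * deleteSig n i k =
      deleteSig n (i + 1) (adj (n + 1) i (adj (n + 1) (i + 1) k)) *
        deleteSig n i (adj (n + 1) (i + 1) k) * deleteSig n (i + 1) k := by
  have hi : i + 1 < n + 1 := by omega
  have hj : i + 1 + 1 < n + 1 := h
  have v1 := adj_cases hi k
  have v2 := adj_cases hj (adj (n + 1) i k)
  have w1 := adj_cases hj k
  have w2 := adj_cases hi (adj (n + 1) (i + 1) k)
  generalize adj (n + 1) (i + 1) (adj (n + 1) i k) = p2 at *
  generalize adj (n + 1) i k = p1 at *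
  generalize adj (n + 1) i (adj (n + 1) (i + 1) k) = q2 at *
  generalize adj (n + 1) (i + 1) k = q1 at *
  obtain h0 | h0 | h0 | h0 | h0 :
      (k : ℕ) < i ∨ (k : ℕ) = i ∨ (k : ℕ) = i + 1 ∨ (k : ℕ) = i + 1 + 1 ∨
        i + 1 + 1 < (k : ℕ) := by omega
  all_goals
    simp (disch := omega) only [deleteSig_lt, deleteSig_eq, deleteSig_gt, one_mul, mul_one,
      Nat.add_sub_cancel]
  · obtain ⟨m, rfl⟩ : ∃ m, i = m + 1 := ⟨i - 1, by omega⟩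
    exact sig_braid (by omega)
  · exact sig_braid (by omega)

/-- The cloning map `κ_k : B_n → B_{n+1}`, doubling the strand that is at position `k` at the
bottom: the map with `clone k (a * b) = clone (ρ_b k) a * clone k b` and
`clone k σ_i = cloneSig n i k`. -/
def clone {n : ℕ} (k : Fin n) (b : Braid n) : Braid (n + 1) :=
  cocycle (cloneSig n) (fun _ _ h h' k => cloneSig_comm h h' k) (fun _ h k => cloneSig_braid h k) k b

theorem clone_mul {n : ℕ} (k : Fin n) (a b : Braid n) :
    clone k (a * b) = clone (perm b k) a * clone k b := cocycle_mul _ _ _ k a b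

theorem clone_sig {n i : ℕ} (hi : i + 1 < n) (k : Fin n) :
    clone k (sig n i) = cloneSig n i k := cocycle_sig _ _ _ hi k

/-- Deletion of the strand that is at position `k` at the bottom: the map with
`delete k (a * b) = delete (ρ_b k) a * delete k b` and `delete k σ_i = deleteSig n i k`. -/
def delete {n : ℕ} (k : Fin (n + 1)) (b : Braid (n + 1)) : Braid n :=
  cocycle (deleteSig n) (fun _ _ h h' k => deleteSig_comm h h' k)
    (fun _ h k => deleteSig_braid h k) k b

theorem delete_mul {n : ℕ} (k : Fin (n + 1)) (a b : Braid (n + 1)) :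
    delete k (a * b) = delete (perm b k) a * delete k b := cocycle_mul _ _ _ k a b

theorem delete_sig {n i : ℕ} (hi : i + 1 < n + 1) (k : Fin (n + 1)) :
    delete k (sig (n + 1) i) = deleteSig n i k := cocycle_sig _ _ _ hi k

theorem clone_one {n : ℕ} (k : Fin n) : clone k (1 : Braid n) = 1 := by
  simpa using clone_mul k 1 1

theorem clone_inv {n : ℕ} (k : Fin n) (b : Braid n) :
    clone k b⁻¹ = (clone (perm b⁻¹ k) b)⁻¹ := by
  have h := clone_mul k b b⁻¹
  rw [mul_inv_cancel, clone_one] at h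
  exact eq_inv_of_mul_eq_one_right h.symm

theorem delete_one {n : ℕ} (k : Fin (n + 1)) : delete k (1 : Braid (n + 1)) = 1 := by
  simpa using delete_mul k 1 1

theorem delete_inv {n : ℕ} (k : Fin (n + 1)) (b : Braid (n + 1)) :
    delete k b⁻¹ = (delete (perm b⁻¹ k) b)⁻¹ := by
  have h := delete_mul k b b⁻¹
  rw [mul_inv_cancel, delete_one] at h
  exact eq_inv_of_mul_eq_one_right h.symm

theorem clonePerm_one {n : ℕ} (k : Fin n) : clonePerm k (1 : Perm (Fin n)) = 1 := by
  simpa using clonePerm_mul k 1 1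

theorem perm_clone {n : ℕ} (k : Fin n) (b : Braid n) :
    perm (clone k b) = clonePerm k (perm b) := by
  induction b using Braid.induction generalizing k with
  | one =>
    rw [clone_one, map_one, map_one]
    exact (clonePerm_one k).symm
  | mul a b ha hb => rw [clone_mul, map_mul, map_mul, ha, hb, clonePerm_mul]
  | inv a ha =>
    have h := clonePerm_mul k (perm a) (perm a⁻¹)
    have h1 : clonePerm k (1 : Perm (Fin n)) = 1 := clonePerm_one k
    rw [clone_inv, map_inv, ha]
    rw [← map_mul, mul_inv_cancel, map_one, h1] at h
    exact (eq_inv_of_mul_eq_one_right h.symm).symm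
  | sig i hi =>
    have hi' : i + 1 < n + 1 := by omega
    have hi'' : i + 1 + 1 < n + 1 := by omega
    have v := adj_cases hi k
    have key : ∀ x : Fin (n + 1), (perm (cloneSig n i k) x : ℕ) =
        if (k : ℕ) < i then (adj (n + 1) (i + 1) x : ℕ)
        else if (k : ℕ) = i then (adj (n + 1) i (adj (n + 1) (i + 1) x) : ℕ)
        else if (k : ℕ) = i + 1 then (adj (n + 1) (i + 1) (adj (n + 1) i x) : ℕ)
        else (adj (n + 1) i x : ℕ) := by
      intro x
      simp only [cloneSig]
      split_ifs <;> simp only [map_mul, perm_sig hi', perm_sig hi'', Perm.mul_apply]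
    ext1 x
    rw [clone_sig hi, perm_sig hi]
    apply Fin.ext
    rw [key]
    have a1 := adj_cases hi' x
    have a2 := adj_cases hi'' x
    have a3 := adj_cases hi' (adj (n + 1) (i + 1) x)
    have a4 := adj_cases hi'' (adj (n + 1) i x)
    generalize adj (n + 1) i (adj (n + 1) (i + 1) x) = p1 at *
    generalize adj (n + 1) (i + 1) (adj (n + 1) i x) = p2 at *
    generalize adj (n + 1) i x = p3 at *
    generalize adj (n + 1) (i + 1) x = p4 at *
    clear key
    induction x using Fin.succAboveCases k.castSucc with
    | x =>
      rw [clonePerm_castSucc]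
      simp only [Fin.val_castSucc] at *
      generalize adj n i k = q at *
      split_ifs <;> omega
    | p j =>
      rw [clonePerm_succAbove]
      have w := adj_cases hi j
      generalize adj n i k = q at *
      generalize adj n i j = r at *
      have e1 : ((k.castSucc.succAbove j : Fin (n + 1)) : ℕ) =
          if (j : ℕ) < k then (j : ℕ) else j + 1 := by
        simp only [Fin.succAbove, Fin.lt_def, apply_ite Fin.val, Fin.val_castSucc, Fin.val_succ]
      have e2 : ((q.castSucc.succAbove r : Fin (n + 1)) : ℕ) =
          if (r : ℕ) < q then (r : ℕ) else r + 1 := by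
        simp only [Fin.succAbove, Fin.lt_def, apply_ite Fin.val, Fin.val_castSucc, Fin.val_succ]
      rw [e2]
      generalize ((k.castSucc.succAbove j : Fin (n + 1)) : ℕ) = y at *
      split_ifs at e1 ⊢ <;> omega

theorem clone_clone_sig {n i : ℕ} (hi : i + 1 < n) {k l : Fin n} (h : k < l) :
    clone l.succ (clone k (sig n i)) = clone k.castSucc (clone l (sig n i)) := by
  have hi' : i + 1 < n + 1 := by omega
  have hi'' : i + 1 + 1 < n + 1 := by omega
  have h' : (k : ℕ) < l := h
  have c : sig (n + 1 + 1) i * sig (n + 1 + 1) (i + 1 + 1) =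
      sig (n + 1 + 1) (i + 1 + 1) * sig (n + 1 + 1) i := sig_comm (by omega)
  have a1 := adj_cases hi' l.succ
  have a2 := adj_cases hi'' l.succ
  have b1 := adj_cases hi' k.castSucc
  have b2 := adj_cases hi'' k.castSucc
  simp only [Fin.val_succ, Fin.val_castSucc] at a1 a2 b1 b2
  rw [clone_sig hi, clone_sig hi]
  obtain ⟨h0, h1⟩ | ⟨h0, h1⟩ | ⟨h0, h1⟩ | ⟨h0, h1⟩ | ⟨h0, h1⟩ | ⟨h0, h1⟩ | ⟨h0, h1⟩ | ⟨h0, h1⟩ :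
    ((k : ℕ) < i ∧ (l : ℕ) < i) ∨ ((k : ℕ) < i ∧ (l : ℕ) = i) ∨
    ((k : ℕ) < i ∧ (l : ℕ) = i + 1) ∨ ((k : ℕ) < i ∧ i + 1 < (l : ℕ)) ∨
    ((k : ℕ) = i ∧ (l : ℕ) = i + 1) ∨ ((k : ℕ) = i ∧ i + 1 < (l : ℕ)) ∨
    ((k : ℕ) = i + 1 ∧ i + 1 < (l : ℕ)) ∨ (i + 1 < (k : ℕ) ∧ i + 1 < (l : ℕ)) := by omega
  all_goals
    have u1 : ((l.succ : Fin (n + 1)) : ℕ) = l + 1 := rfl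
    have u2 : ((k.castSucc : Fin (n + 1)) : ℕ) = k := rfl
    generalize l.succ = l' at *
    generalize k.castSucc = k' at *
    simp (disch := omega) only [cloneSig_lt, cloneSig_eq, cloneSig_succ, cloneSig_gt, clone_mul,
      clone_sig, perm_sig]
  simp only [mul_assoc]
  rw [← mul_assoc (sig (n + 1 + 1) i), c, mul_assoc]

theorem clone_clone {n : ℕ} {k l : Fin n} (h : k < l) (b : Braid n) :
    clone l.succ (clone k b) = clone k.castSucc (clone l b) := by
  have key : ∀ (a b : Braid n), (∀ k l : Fin n, k < l →
      clone l.succ (clone k a) = clone k.castSucc (clone l a)) → ∀ k l : Fin n, k < l →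
      clone (perm (clone k b) l.succ) (clone (perm b k) a) =
        clone (perm (clone l b) k.castSucc) (clone (perm b l) a) := by
    intro a b ha k l h
    rw [perm_clone, perm_clone, clonePerm_succ_of_lt _ h, clonePerm_castSucc_of_lt _ h]
    have hne : perm b k ≠ perm b l := fun e => h.ne ((perm b).injective e)
    rcases lt_or_gt_of_ne hne with h1 | h1
    · rw [Fin.succAbove_castSucc_of_le _ _ h1.le, Fin.succAbove_castSucc_of_lt _ _ h1]
      exact ha _ _ h1
    · rw [Fin.succAbove_castSucc_of_lt _ _ h1, Fin.succAbove_castSucc_of_le _ _ h1.le]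
      exact (ha _ _ h1).symm
  induction b using Braid.induction generalizing k l with
  | one => simp only [clone_one]
  | mul a b ha hb =>
    simp only [clone_mul]
    rw [hb h, key a b (fun _ _ h => ha h) k l h]
  | inv a ha =>
    have h1 := key a a⁻¹ (fun _ _ h => ha h) k l h
    have h2 := clone_mul l.succ (clone (perm a⁻¹ k) a) (clone k a⁻¹)
    have h3 := clone_mul k.castSucc (clone (perm a⁻¹ l) a) (clone l a⁻¹)
    rw [← clone_mul, mul_inv_cancel, clone_one, clone_one] at h2 h3
    rw [h1] at h2
    rw [h3] at h2
    exact (mul_left_cancel h2).symm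
  | sig i hi => exact clone_clone_sig hi h

/-- The permutation of a braid is compatible with deletion of strands. -/
theorem perm_delete {n : ℕ} (k : Fin (n + 1)) (b : Braid (n + 1)) (j : Fin n) :
    (perm b k).succAbove (perm (delete k b) j) = perm b (k.succAbove j) := by
  induction b using Braid.induction generalizing k j with
  | one => simp [delete_one]
  | mul a b ha hb =>
    rw [delete_mul, map_mul, map_mul, Perm.mul_apply, Perm.mul_apply, Perm.mul_apply, ha, hb]
  | inv a ha =>
    have := ha (perm a⁻¹ k) (perm (delete k a⁻¹) j)
    rw [delete_inv, map_inv, ← Perm.mul_apply, mul_inv_cancel,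
      Perm.one_apply, map_inv, ← Perm.mul_apply, mul_inv_cancel, Perm.one_apply] at this
    rw [delete_inv, map_inv, map_inv, this, ← Perm.mul_apply, inv_mul_cancel, Perm.one_apply]
  | sig i hi =>
    rw [delete_sig hi, perm_sig hi]
    have v := adj_cases hi k
    have w := adj_cases hi (k.succAbove j)
    generalize adj (n + 1) i k = k' at *
    generalize adj (n + 1) i (k.succAbove j) = x at *
    have e : ((k.succAbove j : Fin (n + 1)) : ℕ) = if (j : ℕ) < k then (j : ℕ) else j + 1 := by
      simp only [Fin.succAbove, Fin.lt_def, apply_ite Fin.val, Fin.val_castSucc, Fin.val_succ]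
    generalize k.succAbove j = y at *
    apply Fin.ext
    simp only [Fin.succAbove, Fin.lt_def, apply_ite Fin.val, Fin.val_castSucc, Fin.val_succ]
    obtain h0 | h0 | h0 : (k : ℕ) < i ∨ ((k : ℕ) = i ∨ (k : ℕ) = i + 1) ∨ i + 1 < (k : ℕ) := by
      omega
    · rw [deleteSig_lt h0, perm_sig (by omega)]
      have u := adj_cases (show i - 1 + 1 < n by omega) j
      generalize adj n (i - 1) j = j' at *
      split_ifs at e ⊢ <;> omega
    · rw [deleteSig_eq h0, map_one, Perm.one_apply]
      split_ifs at e ⊢ <;> omega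
    · rw [deleteSig_gt h0, perm_sig (by omega)]
      have u := adj_cases (show i + 1 < n by omega) j
      generalize adj n i j = j' at *
      split_ifs at e ⊢ <;> omega

end Braid

/-- The pure braid group `PB_n`: braids whose permutation is trivial. -/
abbrev PureBraid (n : ℕ) : Subgroup (Braid n) := (Braid.perm (n := n)).ker

namespace PureBraid

theorem perm_eq {n : ℕ} (p : PureBraid n) : Braid.perm (p : Braid n) = 1 := p.2

/-- The homomorphism `PB_{n+1} → PB_n` deleting the last (rightmost) strand. -/
def deleteLast (n : ℕ) : PureBraid (n + 1) →* PureBraid n where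
  toFun p := ⟨Braid.delete (Fin.last n) p, by
    rw [MonoidHom.mem_ker]
    ext1 j
    have h := Braid.perm_delete (Fin.last n) (p : Braid (n + 1)) j
    rw [perm_eq, Perm.one_apply, Perm.one_apply] at h
    exact Fin.succAbove_right_injective h⟩
  map_one' := Subtype.ext (Braid.delete_one (Fin.last n))
  map_mul' p q := Subtype.ext (by
    simp only [Subgroup.coe_mul, Braid.delete_mul, perm_eq, Perm.one_apply])

/-- The homomorphism `PB_{m+d} → PB_m` forgetting all strands of a pure braid except for the first
`m` of them. -/
def forget (m : ℕ) : (d : ℕ) → PureBraid (m + d) →* PureBraid m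
  | 0 => MonoidHom.id _
  | d + 1 => (forget m d).comp (deleteLast (m + d))

end PureBraid

/-! ### The braided Thompson group and the kernel of its projection to `V` -/

/-- The braid groups with doubling of strands. -/
def braidSystem : CloningSystem Braid where
  perm := Braid.perm
  clone := Braid.clone
  clone_mul := Braid.clone_mul
  perm_clone := Braid.perm_clone
  clone_clone h b := Braid.clone_clone h b

/-- The braided Thompson group `V_br`: classes of braided paired tree diagrams `(T₋, b, T₊)`. -/
abbrev Vbr : Type := braidSystem.Thompson

/-- The group `P_br`: the kernel of the projection `V_br → V`. -/
noncomputable abbrev Pbr : Subgroup Vbr := braidSystem.toV.ker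

/-- The element of `P_br` represented by `(T, p, T)`, for `p` a pure braid. -/
noncomputable def Pbr.of (T : BTree) (p : PureBraid T.numLeaves) : Pbr :=
  ⟨braidSystem.cls (Diagram.diag T (p : Braid T.numLeaves)), by
    rw [MonoidHom.mem_ker, CloningSystem.toV_cls]
    have h : braidSystem.permDiagram (Diagram.diag T (p : Braid T.numLeaves)) =
        Diagram.diag T 1 := by
      simp only [CloningSystem.permDiagram, Diagram.diag]
      congr 1
      exact p.2
    rw [h, CloningSystem.cls_diag_one]⟩

/-- A group is hopfian if every surjective endomorphism is injective. -/
def IsHopfian (H : Type*) [Group H] : Prop :=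
  ∀ φ : H →* H, Function.Surjective φ → Function.Injective φ

end BraidedThompson

/-! An element of `V_br` with trivial image in `V` has a representative `(T, p, T)` with `p` pure
(`exists_isPure`). A pure braid brings every strand back to its own position, so the strands
belonging to the left subtree `T_L` form a pure braid `p_L` by themselves, and `(T_L, p_L, T_L)` is
again a diagram of this kind.

This assignment is invariant under expansion (`leftPart_expand`). A caret at a leaf of `T_L` expands
the left part at the same leaf; a caret at any other leaf doubles a strand that is forgotten anyway.
For braids this rests on two identities: deleting one of the two copies of a doubled strand undoes
the doubling (`delete_succ_clone`), and doubling one strand commutes with deleting another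
(`delete_clone`). When `T` is a single leaf the left part is set to `1`, which agrees with its
expansion because `B_1` is trivial. Deletion of strands is multiplicative on pure braids, so the
left part defines an endomorphism `phiLeft`.

It is surjective: `(T, p, T)` is the left part of a diagram over the tree with left subtree `T` and
right subtree a leaf, whose braid is `p` with its last strand doubled. It is not injective: over a
single caret the left part is carried by one strand and is trivial, while the class of `σ_0²` over
the caret is not. Indeed doubling strands is injective, so `PB_n` embeds in `P_br` along each fixed
tree (`of_injective`), and `σ_0²` has exponent sum `2`. -/

namespace BraidedThompson

open Equiv

/-! ### Interplay of doubling and deleting strands -/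

namespace Braid

/-- Doubling a strand and then deleting one of the two copies does nothing. -/
theorem delete_succ_clone {n : ℕ} (k : Fin n) (b : Braid n) :
    delete k.succ (clone k b) = b := by
  induction b using Braid.induction generalizing k with
  | one => rw [clone_one, delete_one]
  | mul a b ha hb => rw [clone_mul, delete_mul, perm_clone, clonePerm_succ, ha, hb]
  | inv a ha =>
    -- The right-hand copy at the bottom of `clone k a⁻¹` ends as the right-hand copy of strand
    -- `perm a⁻¹ k` at the top; this is the position that `delete_inv` asks for.
    have h := clonePerm_succ k (perm a⁻¹)
    rw [← perm_clone, clone_inv] at h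
    rw [clone_inv, delete_inv, h, ha]
  | sig i hi =>
    rw [clone_sig hi]
    -- From here on only the numerical positions matter: with `k.succ` generalized, `omega` selects
    -- the right clause of `cloneSig` and `deleteSig` in each case.
    have u : (k.succ : ℕ) = k + 1 := rfl
    have a1 := adj_cases (show i + 1 < n + 1 by omega) k.succ
    have a2 := adj_cases (show i + 1 + 1 < n + 1 by omega) k.succ
    generalize k.succ = k' at *
    obtain h | h | h | h : (k : ℕ) < i ∨ (k : ℕ) = i ∨ (k : ℕ) = i + 1 ∨ i + 1 < (k : ℕ) := by
      omega
    all_goals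
      simp (disch := omega) only [cloneSig_lt, cloneSig_eq, cloneSig_succ, cloneSig_gt,
        delete_mul, delete_sig, perm_sig, deleteSig_lt, deleteSig_eq, deleteSig_gt, one_mul,
        mul_one, Nat.add_sub_cancel]

/-- Doubling a strand commutes with deleting a different strand. -/
theorem delete_clone {n : ℕ} (j : Fin (n + 1)) (k : Fin n) (b : Braid (n + 1)) :
    delete ((j.succAbove k).castSucc.succAbove j) (clone (j.succAbove k) b) =
      clone k (delete j b) := by
  -- Where strand `j` ends at the top after strand `j.succAbove k` has been doubled. It has the same
  -- form as the bottom position in the statement, which lets the crossed product rules for `clone`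
  -- and `delete` match.
  have key : ∀ b : Braid (n + 1), ∀ (j : Fin (n + 1)) (k : Fin n),
      perm (clone (j.succAbove k) b) ((j.succAbove k).castSucc.succAbove j) =
        ((perm b j).succAbove (perm (delete j b) k)).castSucc.succAbove (perm b j) := by
    intro b j k
    rw [perm_clone, clonePerm_succAbove, perm_delete]
  induction b using Braid.induction generalizing j k with
  | one => simp only [clone_one, delete_one]
  | mul a b ha hb =>
    rw [clone_mul, delete_mul, delete_mul, clone_mul, key, ← perm_delete, ha, hb]
  | inv a ha =>
    -- Both sides are multiplied on the left by the factor that the crossed product rule for `a *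
    -- a⁻¹` prescribes, so that both become the doubled and deleted trivial braid.
    rw [← mul_right_inj (clone (perm (delete j a⁻¹) k) (delete (perm a⁻¹ j) a)), ← clone_mul,
      ← delete_mul, mul_inv_cancel, delete_one, clone_one, ← ha, ← key, perm_delete,
      ← delete_mul, ← clone_mul, mul_inv_cancel, clone_one, delete_one]
  | sig i hi =>
    have e1 : ((j.succAbove k : Fin (n + 1)) : ℕ) = if (k : ℕ) < j then (k : ℕ) else k + 1 := by
      simp only [Fin.succAbove, Fin.lt_def, apply_ite Fin.val, Fin.val_castSucc, Fin.val_succ]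
    generalize j.succAbove k = l at *
    have e2 : ((l.castSucc.succAbove j : Fin (n + 2)) : ℕ) =
        if (j : ℕ) < l then (j : ℕ) else j + 1 := by
      simp only [Fin.succAbove, Fin.lt_def, apply_ite Fin.val, Fin.val_castSucc, Fin.val_succ]
    generalize l.castSucc.succAbove j = m at *
    have a1 := adj_cases (show i + 1 < n + 1 + 1 by omega) m
    have a2 := adj_cases (show i + 1 + 1 < n + 1 + 1 by omega) m
    rw [clone_sig hi, delete_sig hi]
    obtain h | h | h | h : (j : ℕ) < i ∨ (j : ℕ) = i ∨ (j : ℕ) = i + 1 ∨ i + 1 < (j : ℕ) := by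
      omega
    -- The positions of the deleted strand `j` and the doubled strand `l` relative to `i` and `i +
    -- 1` are listed; `e1` rules out `j = l`, and `omega` discards the inconsistent combinations.
    all_goals
      obtain h' | h' | h' | h' :
        (l : ℕ) < i ∨ (l : ℕ) = i ∨ (l : ℕ) = i + 1 ∨ i + 1 < (l : ℕ) := by omega
    all_goals
      split_ifs at e1 e2
    all_goals first
      | omega
      | (simp (disch := omega) only [cloneSig_lt, cloneSig_eq, cloneSig_succ, cloneSig_gt,
          delete_mul, delete_sig, perm_sig, deleteSig_lt, deleteSig_eq, deleteSig_gt, mul_one,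
          Nat.add_sub_cancel, clone_sig, clone_one, Nat.sub_add_cancel])

theorem perm_delete_last_eq_one {n : ℕ} {b : Braid (n + 1)} (hb : perm b = 1) :
    perm (delete (Fin.last n) b) = 1 := by
  ext1 j
  have h := perm_delete (Fin.last n) b j
  rw [hb, Perm.one_apply, Perm.one_apply] at h
  exact Fin.succAbove_right_injective h

theorem perm_clone_eq_one {n : ℕ} (k : Fin n) {b : Braid n} (hb : perm b = 1) :
    perm (clone k b) = 1 := by
  rw [perm_clone, hb]
  exact clonePerm_one k

theorem eq_one_of_le_one {n : ℕ} (hn : n ≤ 1) (b : Braid n) : b = 1 := by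
  induction b using Braid.induction with
  | one => rfl
  | mul a b ha hb => rw [ha, hb, one_mul]
  | inv a ha => rw [ha, inv_one]
  | sig i hi => omega

/-! ### Keeping the first strands of a braid -/

/-- The braid consisting of the strands of `b` that are among the first `m` at the bottom. -/
def keep (m : ℕ) : {n : ℕ} → Braid n → Braid m
  -- For `m = 0` this is the only value. For `n < m` the recursion ends here with the default value
  -- `1`.
  | 0, _ => 1
  | n + 1, b => if h : n + 1 = m then h ▸ b else keep m (delete (Fin.last n) b)

theorem keep_self {n : ℕ} (b : Braid n) : keep n b = b := by
  cases n with
  | zero => exact (eq_one_of_le_one zero_le_one b).symm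
  | succ n => simp [keep]

theorem keep_of_lt {m n : ℕ} (h : m < n + 1) (b : Braid (n + 1)) :
    keep m b = keep m (delete (Fin.last n) b) := by
  rw [keep, dif_neg (by omega)]

theorem perm_keep {m n : ℕ} {b : Braid n} (hb : perm b = 1) : perm (keep m b) = 1 := by
  induction n with
  | zero => exact map_one _
  | succ n ih =>
    rw [keep]
    split_ifs with h
    · subst h; exact hb
    · exact ih (perm_delete_last_eq_one hb)

/-- Deletion is only a crossed homomorphism: the strand to delete from `a` is the one that `b` leads
to. Purity of `b` makes it the last strand again, at every stage of the recursion. -/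
theorem keep_mul {m n : ℕ} (a : Braid n) {b : Braid n} (hb : perm b = 1) :
    keep m (a * b) = keep m a * keep m b := by
  induction n with
  | zero => exact (one_mul 1).symm
  | succ n ih =>
    simp only [keep]
    split_ifs with h
    · subst h; rfl
    · rw [delete_mul, hb, Perm.one_apply, ih _ (perm_delete_last_eq_one hb)]

theorem delete_last_clone {n : ℕ} (k : Fin n) (b : Braid (n + 1)) :
    delete (Fin.last (n + 1)) (clone k.castSucc b) = clone k (delete (Fin.last n) b) := by
  have h := delete_clone (Fin.last n) k b
  rwa [Fin.succAbove_last, Fin.succAbove_of_lt_succ _ _ (Fin.castSucc_lt_last _),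
    Fin.succ_last] at h

/-- The doubled strand is among those to be forgotten. Strands are deleted from the right, commuting
with the doubling, until the doubled strand is last; then the next deletion removes its copy. -/
theorem keep_clone_of_le {m n : ℕ} (k : Fin n) (h : m ≤ k) (b : Braid n) :
    keep m (clone k b) = keep m b := by
  induction n with
  | zero => exact k.elim0
  | succ n ih =>
    rw [keep_of_lt (by omega)]
    induction k using Fin.lastCases with
    | last => rw [← Fin.succ_last, delete_succ_clone]
    | cast k =>
      have hk := k.2
      rw [Fin.val_castSucc] at h
      rw [delete_last_clone, ih k h, keep_of_lt (by omega)]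

/-- The doubled strand is kept together with its copy, so every deletion concerns a different strand
and commutes with the doubling. -/
theorem keep_clone_of_lt {m n : ℕ} (hmn : m ≤ n) (k : Fin m) (b : Braid n) :
    keep (m + 1) (clone (Fin.castLE hmn k) b) = clone k (keep m b) := by
  induction n with
  | zero => exact (Fin.castLE hmn k).elim0
  | succ n ih =>
    obtain rfl | h := hmn.eq_or_lt
    · rw [keep_self, keep_self]; rfl
    · have hmn' : m ≤ n := by omega
      rw [keep_of_lt (by omega), keep_of_lt h, ← ih hmn', ← delete_last_clone]
      rfl

/-- Doubling the last strand is a section of forgetting it; this yields the surjectivity of the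
endomorphism. -/
theorem keep_clone_last {m : ℕ} (b : Braid (m + 1)) :
    keep (m + 1) (clone (Fin.last m) b) = b := by
  rw [keep_of_lt (by omega), ← Fin.succ_last, delete_succ_clone, keep_self]

theorem clone_injective {n : ℕ} (k : Fin n) : Function.Injective (clone k) :=
  Function.LeftInverse.injective (g := delete k.succ) (delete_succ_clone k)

/-- The exponent sum `B_2 → ℤ`, written multiplicatively, takes the value `2` on this braid. -/
theorem sig_sq_ne_one : sig 2 0 * sig 2 0 ≠ 1 := by
  intro h
  have e := lift_sig (n := 2) (fun _ => Multiplicative.ofAdd (1 : ℤ)) (fun _ _ _ _ => rfl)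
    (fun _ _ => rfl) (i := 0) (by omega)
  have := congrArg (lift (n := 2) (fun _ => Multiplicative.ofAdd (1 : ℤ)) (fun _ _ _ _ => rfl)
    (fun _ _ => rfl)) h
  rw [MonoidHom.map_mul, e, MonoidHom.map_one] at this
  exact absurd this (by decide)

theorem perm_sig_sq {n i : ℕ} (hi : i + 1 < n) : perm (sig n i * sig n i) = 1 := by
  rw [map_mul, perm_sig hi, adj, dif_pos hi, swap_mul_self]

end Braid

/-- `keep` needs no decomposition `n = m + d` of the number of strands, which makes it convenient
under expansion; this links it to the forgetful homomorphism. -/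
theorem PureBraid.coe_forget (m d : ℕ) (p : PureBraid (m + d)) :
    (PureBraid.forget m d p : Braid m) = Braid.keep m (p : Braid (m + d)) := by
  induction d with
  | zero => exact (Braid.keep_self (n := m) p.1).symm
  | succ d ih =>
    refine (ih (PureBraid.deleteLast (m + d) p)).trans ?_
    exact (Braid.keep_of_lt (n := m + d) (by omega) p.1).symm

/-! ### Pure diagrams and faithfulness over a fixed tree -/

namespace CloningSystem

variable {G : ℕ → Type} [∀ n, Group (G n)] (C : CloningSystem G)

/-- If the cloning maps are injective, then so is iterated expansion along a given tree. -/
theorem heq_elt_of_steps (hC : ∀ {n : ℕ} (k : Fin n), Function.Injective (C.clone k))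
    {x y z : Diagram G} (hx : C.Steps x z) (hy : C.Steps y z) (h : x.bot = y.bot) :
    HEq x.elt y.elt := by
  induction hx using Relation.ReflTransGen.head_induction_on generalizing y with
  | refl => rw [Steps.eq_of_bot C hy .refl h]
  | head hs hxz ih =>
    obtain ⟨k, rfl⟩ := hs
    rename_i x
    obtain ⟨n, S, T, h1, h2, a⟩ := x
    obtain ⟨m, S', T', h3, h4, b⟩ := y
    obtain rfl : T = T' := h
    obtain rfl : n = m := h2.symm.trans h4
    have hE := Steps.ext_bot C hxz
    -- The first expansion on the way from `x` to `z` is copied on `y`. An expansion is determined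
    -- by its bottom tree, so continuing to `z.bot` ends in `z` itself; induction then compares the
    -- two elements after doubling strand `k`.
    obtain ⟨w, hw, hwz⟩ := C.exists_steps_bot (C.expand ⟨n, S', T, h3, h4, b⟩ k) z.bot hE
    have hs : C.Step ⟨n, S', T, h3, h4, b⟩ (C.expand ⟨n, S', T, h3, h4, b⟩ k) := ⟨k, rfl⟩
    obtain rfl : w = z := Steps.eq_of_bot C (hw.head hs) hy hwz
    exact heq_of_eq (hC k (eq_of_heq (ih hw rfl)))

/-- A diagram of the form `(T, g, T)` with `g` of trivial permutation. -/
def IsPure (x : Diagram G) : Prop := x.top = x.bot ∧ C.perm x.elt = 1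

variable {C}

theorem IsPure.expand {x : Diagram G} (h : C.IsPure x) (k : Fin x.n) : C.IsPure (C.expand x k) := by
  refine ⟨?_, ?_⟩
  · simp only [CloningSystem.expand, h.1, h.2, Perm.one_apply]
  · change C.perm (C.clone k x.elt) = 1
    rw [C.perm_clone, h.2, Braid.clonePerm_one]

theorem IsPure.steps {x y : Diagram G} (h : C.IsPure x) (hs : C.Steps x y) : C.IsPure y := by
  induction hs with
  | refl => exact h
  | tail _ h ih =>
    obtain ⟨k, rfl⟩ := h
    exact ih.expand k

theorem IsPure.toV {x : Diagram G} (h : C.IsPure x) : C.toV (C.cls x) = 1 := by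
  obtain ⟨n, S, T, h1, h2, g⟩ := x
  obtain ⟨h3, h4⟩ := h
  obtain rfl : S = T := h3
  rw [toV_cls]
  simp only [permDiagram]
  erw [h4]
  exact permSystem.cls_one_of_eq n S h1 h2

/-- The permutation diagram of `x` shares an expansion `z` with the identity diagram, and expansions
of the identity diagram are pure. Expanding `x` itself along the bottom tree of `z` gives a diagram
lying over `z`, hence pure. -/
theorem exists_isPure {g : C.Thompson} (hg : C.toV g = 1) : ∃ x, C.IsPure x ∧ C.cls x = g := by
  obtain ⟨x, rfl⟩ := C.exists_cls g
  rw [toV_cls] at hg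
  obtain ⟨z, h1, h2⟩ := permSystem.cls_eq_iff.1 (hg.trans (permSystem.cls_diag_one .nil).symm)
  have hz : permSystem.IsPure z := IsPure.steps ⟨rfl, rfl⟩ h2
  obtain ⟨y, hy, hyz⟩ := C.exists_steps_bot x z.bot (Steps.ext_bot permSystem h1)
  obtain rfl : C.permDiagram y = z := Steps.eq_of_bot _ (Steps.permDiagram C hy) h1 hyz
  exact ⟨y, hz, (C.cls_eq_of_steps hy).symm⟩

end CloningSystem

/-! ### The left part of a pure diagram -/

/-- The class of `(T_L, b', T_L)`, where `T_L` is the left subtree of the lower tree of a diagram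
`(S, b, T)` and `b'` consists of the strands of `b` belonging to `T_L`. -/
def leftPart (x : Diagram Braid) : Vbr :=
  match x.bot with
  -- The value forced by invariance: after one expansion the left subtree is a leaf, carrying a
  -- braid on one strand.
  | .nil => 1
  | .node _ L _ => braidSystem.cls ⟨_, L, L, rfl, rfl, Braid.keep L.numLeaves x.elt⟩

theorem leftPart_of_bot_eq_nil {x : Diagram Braid} (h : x.bot = .nil) : leftPart x = 1 := by
  simp only [leftPart, h]

theorem leftPart_of_bot_eq_node {x : Diagram Braid} {L R : BTree} (h : x.bot = .node () L R) :
    leftPart x = braidSystem.cls ⟨_, L, L, rfl, rfl, Braid.keep L.numLeaves x.elt⟩ := by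
  simp only [leftPart, h]

theorem cls_diag_eq_one_of_numLeaves_le_one {T : BTree} (hT : T.numLeaves ≤ 1)
    (b : Braid T.numLeaves) : braidSystem.cls (.diag T b) = 1 := by
  rw [Braid.eq_one_of_le_one hT b, CloningSystem.cls_diag_one]

/-- Purity is essential: the left part has `T_L` both on top and at the bottom, so the new caret has
to sit at the same leaf of both. Inside `T_L` the left part is itself expanded; outside, it does not
change. -/
theorem leftPart_expand {x : Diagram Braid} (hx : braidSystem.IsPure x) (k : Fin x.n) :
    leftPart (braidSystem.expand x k) = leftPart x := by
  obtain ⟨n, S, T, h1, h2, b⟩ := x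
  obtain ⟨hST, hb⟩ := hx
  obtain rfl : S = T := hST
  change Braid.perm b = 1 at hb
  change Fin n at k
  cases S with
  | nil =>
    refine Eq.trans ?_ (leftPart_of_bot_eq_nil (x := ⟨n, .nil, .nil, h1, h2, b⟩) rfl).symm
    rw [leftPart_of_bot_eq_node (L := .nil) (R := .nil) (by simp [CloningSystem.expand, addCaret])]
    exact cls_diag_eq_one_of_numLeaves_le_one (T := .nil) le_rfl _
  | node u L R =>
    have hn : L.numLeaves ≤ n := by rw [← h2, BinaryTree.numLeaves]; omega
    rw [leftPart_of_bot_eq_node (x := ⟨n, .node () L R, .node () L R, h1, h2, b⟩) rfl]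
    by_cases hk : (k : ℕ) < L.numLeaves
    · rw [leftPart_of_bot_eq_node (L := addCaret L k) (R := R)
        (by simp [CloningSystem.expand, addCaret, hk])]
      -- The right-hand side is replaced by its expansion at leaf `k`; the two diagrams then agree,
      -- not merely their classes.
      rw [braidSystem.cls_eq_of_steps
        (x := ⟨_, L, L, rfl, rfl, Braid.keep L.numLeaves b⟩)
        (.single ⟨(⟨k, hk⟩ : Fin L.numLeaves), rfl⟩)]
      have hp : Braid.perm (Braid.keep L.numLeaves b) = 1 := Braid.perm_keep hb
      have hc := Braid.keep_clone_of_lt hn ⟨k, hk⟩ b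
      congr 1
      ext1
      · exact numLeaves_addCaret _ _
      · simp only [CloningSystem.expand]
        erw [hp]; rfl
      · rfl
      · refine HEq.trans ?_ (heq_of_eq hc)
        -- The number of leaves of `addCaret L k` equals `L.numLeaves + 1` only propositionally,
        -- hence the heterogeneous equality.
        change HEq (Braid.keep (addCaret L k).numLeaves (Braid.clone k b)) _
        rw [numLeaves_addCaret]
        rfl
    · rw [leftPart_of_bot_eq_node (L := L) (R := addCaret R (k - L.numLeaves))
        (by simp [CloningSystem.expand, addCaret, hk])]
      have hc := Braid.keep_clone_of_le k (not_lt.1 hk) b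
      congr 2

theorem leftPart_steps {x y : Diagram Braid} (hx : braidSystem.IsPure x)
    (h : braidSystem.Steps x y) : leftPart y = leftPart x := by
  induction h with
  | refl => rfl
  | tail h' h ih =>
    obtain ⟨k, rfl⟩ := h
    rw [leftPart_expand (hx.steps h'), ih]

theorem leftPart_eq_of_cls_eq {x y : Diagram Braid} (hx : braidSystem.IsPure x)
    (hy : braidSystem.IsPure y) (h : braidSystem.cls x = braidSystem.cls y) :
    leftPart x = leftPart y := by
  obtain ⟨z, h1, h2⟩ := braidSystem.cls_eq_iff.1 h
  rw [← leftPart_steps hx h1, leftPart_steps hy h2]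

theorem leftPart_mul {x y w : Diagram Braid} (hx : braidSystem.IsPure x)
    (hy : braidSystem.IsPure y) (h : Diagram.Comp x y w) :
    leftPart w = leftPart x * leftPart y := by
  cases h with
  | mk n T₁ T₂ T₃ h₁ h₂ h₃ a b =>
  obtain ⟨e1, -⟩ := hx
  obtain ⟨e2, hb⟩ := hy
  obtain rfl : T₁ = T₂ := e1
  obtain rfl : T₁ = T₃ := e2
  cases T₁ with
  | nil => exact (one_mul 1).symm
  | node u L R =>
    have hk : Braid.keep L.numLeaves (a * b) =
        Braid.keep L.numLeaves a * Braid.keep L.numLeaves b :=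
      Braid.keep_mul a hb
    simp only [leftPart, hk]
    exact (braidSystem.cls_mul_cls_of_comp (.mk ..)).symm

theorem toV_leftPart {x : Diagram Braid} (hx : braidSystem.IsPure x) :
    braidSystem.toV (leftPart x) = 1 := by
  obtain ⟨n, S, T, h1, h2, b⟩ := x
  cases T with
  | nil => exact map_one _
  | node u L R => exact CloningSystem.IsPure.toV ⟨rfl, Braid.perm_keep hx.2⟩

/-! ### The endomorphism of `P_br` -/

namespace Pbr

theorem isPure_diag (T : BTree) (p : PureBraid T.numLeaves) :
    braidSystem.IsPure (Diagram.diag T (p : Braid T.numLeaves)) := ⟨rfl, p.2⟩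

/-- A diagram `(T, p, T)` with `p` pure, representing the given element. -/
noncomputable def rep (g : Pbr) : Diagram Braid := (CloningSystem.exists_isPure g.2).choose

theorem isPure_rep (g : Pbr) : braidSystem.IsPure (rep g) :=
  (CloningSystem.exists_isPure g.2).choose_spec.1

theorem cls_rep (g : Pbr) : braidSystem.cls (rep g) = g :=
  (CloningSystem.exists_isPure g.2).choose_spec.2

/-- The endomorphism of `P_br` with `(T, p, T) ↦ (T_L, p_L, T_L)`, where `p_L` is obtained from `p`
by forgetting the strands that do not belong to the left subtree `T_L`. -/
noncomputable def phiLeft : Pbr →* Pbr :=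
  MonoidHom.mk' (fun g => ⟨leftPart (rep g), toV_leftPart (isPure_rep g)⟩) (by
    intro g h
    apply Subtype.ext
    change leftPart (rep (g * h)) = leftPart (rep g) * leftPart (rep h)
    -- The representatives are expanded until they can be stacked. Expansion preserves purity and
    -- left parts, and the stacked diagram `w` is a pure representative of `g * h`, though not
    -- necessarily the chosen one.
    obtain ⟨w, x, y, hx, hy, hw⟩ := braidSystem.exists_isProduct (rep g) (rep h)
    have hx' := (isPure_rep g).steps hx
    have hy' := (isPure_rep h).steps hy
    have hw' : braidSystem.IsPure w := by
      cases hw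
      refine ⟨hx'.1.trans hy'.1, ?_⟩
      rw [map_mul]
      erw [hx'.2, hy'.2, one_mul]
    rw [← leftPart_steps (isPure_rep g) hx, ← leftPart_steps (isPure_rep h) hy,
      ← leftPart_mul hx' hy' hw]
    refine leftPart_eq_of_cls_eq (isPure_rep _) hw' ?_
    rw [cls_rep, Subgroup.coe_mul, ← cls_rep g, ← cls_rep h]
    exact braidSystem.cls_mul_cls ⟨x, y, hx, hy, hw⟩)

/-- Any pure representative may be used in place of the chosen one, since equivalent pure diagrams
have equal left parts. -/
theorem coe_phiLeft {g : Pbr} {x : Diagram Braid} (hx : braidSystem.IsPure x)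
    (h : braidSystem.cls x = g) : (phiLeft g : Vbr) = leftPart x :=
  leftPart_eq_of_cls_eq (isPure_rep g) hx ((cls_rep g).trans h.symm)

theorem phiLeft_of (L R : BTree) (p : PureBraid (L.numLeaves + R.numLeaves)) :
    phiLeft (of (.node () L R) p) = of L (PureBraid.forget L.numLeaves R.numLeaves p) := by
  apply Subtype.ext
  rw [coe_phiLeft (isPure_diag (.node () L R) p) rfl]
  change _ = braidSystem.cls (.diag L (PureBraid.forget L.numLeaves R.numLeaves p : Braid _))
  rw [PureBraid.coe_forget]
  rfl

theorem exists_of (g : Pbr) : ∃ T p, of T p = g := by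
  obtain ⟨x, hx, h⟩ := CloningSystem.exists_isPure g.2
  obtain ⟨n, S, T, h1, h2, b⟩ := x
  obtain rfl : S = T := hx.1
  subst h1
  exact ⟨S, ⟨b, hx.2⟩, Subtype.ext h⟩

theorem forget_one_surjective {m : ℕ} (hm : 0 < m) :
    Function.Surjective (PureBraid.forget m 1) := by
  intro p
  obtain ⟨m, rfl⟩ := Nat.exists_eq_succ_of_ne_zero hm.ne'
  refine ⟨⟨Braid.clone (Fin.last m) p, Braid.perm_clone_eq_one _ p.2⟩, Subtype.ext ?_⟩
  rw [PureBraid.coe_forget]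
  exact Braid.keep_clone_last p.1

theorem phiLeft_surjective : Function.Surjective phiLeft := by
  intro g
  obtain ⟨T, p, rfl⟩ := exists_of g
  obtain ⟨q, rfl⟩ := forget_one_surjective T.numLeaves_pos p
  -- The preimage lives over the tree with left subtree `T` and right subtree a leaf; its one
  -- additional strand is the one that `forget _ 1` removes.
  exact ⟨_, phiLeft_of T .nil q⟩

/-- Equal classes have a common expansion, and doubling strands loses no information about the
braid. -/
theorem of_injective (T : BTree) : Function.Injective (of T) := by
  intro p q h
  obtain ⟨z, h1, h2⟩ := braidSystem.cls_eq_iff.1 (congrArg Subtype.val h)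
  exact Subtype.ext (eq_of_heq (braidSystem.heq_elt_of_steps Braid.clone_injective h1 h2 rfl))

theorem phiLeft_not_injective : ¬ Function.Injective phiLeft := by
  intro h
  -- The full twist on the two strands of a caret. Its left part has a single strand, so `phiLeft`
  -- cannot tell it from the trivial braid.
  let p : PureBraid (BinaryTree.node () .nil .nil : BTree).numLeaves :=
    ⟨Braid.sig 2 0 * Braid.sig 2 0, Braid.perm_sig_sq (n := 2) (by omega)⟩
  have e : of (.node () .nil .nil) p = of (.node () .nil .nil) 1 := by
    apply h
    apply Subtype.ext
    rw [coe_phiLeft (isPure_diag _ _) rfl, coe_phiLeft (isPure_diag _ _) rfl]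
    exact (cls_diag_eq_one_of_numLeaves_le_one (T := .nil) le_rfl _).trans
      (cls_diag_eq_one_of_numLeaves_le_one (T := .nil) le_rfl _).symm
  exact Braid.sig_sq_ne_one (congrArg Subtype.val (of_injective _ e))

end Pbr

end BraidedThompson

theorem proposition4p5 :
    ¬ BraidedThompson.IsHopfian BraidedThompson.Pbr ∧
    ∃ φ : BraidedThompson.Pbr →* BraidedThompson.Pbr,
      (∀ (L R : BraidedThompson.BTree)
          (p : BraidedThompson.PureBraid (L.numLeaves + R.numLeaves)),
        φ (BraidedThompson.Pbr.of (.node () L R) p) =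
          BraidedThompson.Pbr.of L
            (BraidedThompson.PureBraid.forget L.numLeaves R.numLeaves p)) ∧
      Function.Surjective φ ∧ ¬ Function.Injective φ :=
  ⟨fun h => BraidedThompson.Pbr.phiLeft_not_injective
      (h _ BraidedThompson.Pbr.phiLeft_surjective),
    BraidedThompson.Pbr.phiLeft, BraidedThompson.Pbr.phiLeft_of,
    BraidedThompson.Pbr.phiLeft_surjective, BraidedThompson.Pbr.phiLeft_not_injective⟩
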